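/- All graphs are finite and simple. $G+H$ is the disjoint union of $G$ and $H$, $nG$ is the disjoint union of $n$ copies of $G$, $G\oplus H$ is the join (the disjoint union together with all edges between $G$ and $H$), and $\overline G$ is the complement. $K_n$, $P_n$, $C_n$ are the complete graph, the path and the cycle on $n$ vertices. Cographs are the graphs, up to isomorphism, obtained from $K_1$ by complementation and disjoint union. A cluster is the complement of a complete multipartite graph (equivalently, a disjoint union of complete graphs). A graph is $(\infty,k)$-polar if its vertex set has a partition $(A,B)$, with $A$ or $B$ possibly empty, such that $A$ induces a complete multipartite graph (with any number of parts) and $B$ induces a cluster with at most $k$ connected components. A cograph minimal $(\infty,k)$-polar obstruction is a cograph that is not $(\infty,k)$-polar but all of whose proper induced subgraphs are $(\infty,k)$-polar; it has type $(c,i)$ if it has exactly $c$ connected components and precisely $i$ of them consist of a single vertex. Let $k\ge 2$ be an integer. A graph $G$ is a cograph minimal $(\infty,k)$-polar obstruction of type $(k+1,k)$ if and only if $G\cong kK_1+H$, where $H$ is isomorphic to one of the seven graphs \[ \overline{2P_3},\quad (P_3+K_2)\oplus K_1,\quad 2K_2\oplus K_2,\quad K_1\oplus(C_4+K_1),\quad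 K_1\oplus\overline{P_3+K_2},\quad \overline{K_2}\oplus(P_3+K_1),\quad \overline{K_2}\oplus(K_2+kK_1). \] -/

import Mathlib

namespace CographPolar

universe u v

/-- The join of `G` and `H`: their disjoint union together with all the edges between them. -/
def join {V : Type u} {W : Type v} (G : SimpleGraph V) (H : SimpleGraph W) :
    SimpleGraph (V ⊕ W) :=
  (G ⊕g H) ⊔ completeBipartiteGraph V W

infixl:60 " ⊕j " => CographPolar.join

/-- Cographs: the smallest isomorphism-closed class of graphs that contains `K₁` and is closed
under complementation and disjoint union. -/
inductive IsCograph : {V : Type u} → SimpleGraph V → Prop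
  | single (G : SimpleGraph PUnit.{u + 1}) : IsCograph G
  | compl {V : Type u} (G : SimpleGraph V) : IsCograph G → IsCograph Gᶜ
  | disjUnion {V W : Type u} (G : SimpleGraph V) (H : SimpleGraph W) :
      IsCograph G → IsCograph H → IsCograph (G ⊕g H)
  | iso {V W : Type u} (G : SimpleGraph V) (H : SimpleGraph W) (e : G ≃g H) :
      IsCograph G → IsCograph H

/-- A complete multipartite graph with at most `s` parts, `s ∈ {0, 1, 2, …, ∞}`. The parts are the
connected components of the complement. -/
def IsCompletePartite {V : Type u} (s : ℕ∞) (G : SimpleGraph V) : Prop :=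
  G.IsCompleteMultipartite ∧ ENat.card Gᶜ.ConnectedComponent ≤ s

/-- A cluster is the complement of a complete multipartite graph. -/
def IsCluster {V : Type u} (G : SimpleGraph V) : Prop :=
  Gᶜ.IsCompleteMultipartite

/-- A cluster with at most `k` connected components, `k ∈ {0, 1, 2, …, ∞}`. -/
def IsKCluster {V : Type u} (k : ℕ∞) (G : SimpleGraph V) : Prop :=
  IsCluster G ∧ ENat.card G.ConnectedComponent ≤ k

/-- `G` is `(s, k)`-polar: its vertex set is partitioned into `A` and `Aᶜ` (either may be empty),
where `A` induces a complete `s`-partite graph and `Aᶜ` induces a `k`-cluster. -/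
def IsPolar {V : Type u} (s k : ℕ∞) (G : SimpleGraph V) : Prop :=
  ∃ A : Set V, IsCompletePartite s (G.induce A) ∧ IsKCluster k (G.induce Aᶜ)

/-- A cograph minimal `(s, k)`-polar obstruction: a cograph that is not `(s, k)`-polar, all of
whose proper induced subgraphs are `(s, k)`-polar. -/
def IsMinimalObstruction {V : Type u} (s k : ℕ∞) (G : SimpleGraph V) : Prop :=
  IsCograph G ∧ ¬ IsPolar s k G ∧ ∀ S : Set V, S ≠ Set.univ → IsPolar s k (G.induce S)

/-- `G` has exactly `c` connected components, precisely `i` of which are trivial, that is, consist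
of a single vertex. -/
def HasType {V : Type u} (c i : ℕ) (G : SimpleGraph V) : Prop :=
  Nat.card G.ConnectedComponent = c ∧
    Nat.card {C : G.ConnectedComponent // Nat.card C.supp = 1} = i

/-- The complete graph on `n` vertices. -/
abbrev K (n : ℕ) : SimpleGraph (Fin n) := ⊤

/-- The disjoint union of `n` isolated vertices, `n K₁`; this is also the complement of `K n`. -/
abbrev isolated (n : ℕ) : SimpleGraph (Fin n) := ⊥

/-- The path on three vertices. -/
abbrev P₃ : SimpleGraph (Fin 3) := SimpleGraph.pathGraph 3

/-- The cycle on four vertices. -/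
abbrev C₄ : SimpleGraph (Fin 4) := SimpleGraph.cycleGraph 4

/-- `H` is isomorphic to one of the seven listed graphs (the last of which depends on `k`). -/
def InList {W : Type v} (k : ℕ) (H : SimpleGraph W) : Prop :=
  Nonempty (H ≃g (P₃ ⊕g P₃)ᶜ) ∨
  Nonempty (H ≃g (P₃ ⊕g K 2) ⊕j K 1) ∨
  Nonempty (H ≃g (K 2 ⊕g K 2) ⊕j K 2) ∨
  Nonempty (H ≃g K 1 ⊕j (C₄ ⊕g K 1)) ∨
  Nonempty (H ≃g K 1 ⊕j (P₃ ⊕g K 2)ᶜ) ∨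
  Nonempty (H ≃g (K 2)ᶜ ⊕j (P₃ ⊕g K 1)) ∨
  Nonempty (H ≃g (K 2)ᶜ ⊕j (K 2 ⊕g isolated k))

end CographPolar

namespace CographPolar

universe u v w

open SimpleGraph

/-! ### Adjacency in joins -/

section Adjacency

variable {V : Type u} {W : Type v} {G : SimpleGraph V} {H : SimpleGraph W}

/-! Everything reduces to the nontrivial component `H`. If the multipartite side of a polar
partition of `kK₁ + H` contains an edge of `H`, no isolated vertex can lie there; the `k` isolated
vertices then use up the `k` clusters, and all of `H` is complete multipartite. Otherwise `H` is
`(1, k)`-polar, i.e. monopolar with `k` clusters (`hasPolarColoring_isolated_sum_iff`). With one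
isolated vertex fewer, a single cluster is left over for `H`, so in a minimal obstruction `H` is
`(∞, 1)`-polar (`HasPolarColoring.one_or_hasMonopolarColoring`). The converse needs exactly the
conditions in `IsCritical`, together with `H` being a connected cograph.

The core is `containsListed`. Since `H` is not complete multipartite, some component `X` of its
complement contains a co-`P₃`. As `H` is a connected cograph, `X` is a proper subset, joined to the
rest `Y`, and induces a disconnected graph. The cases are: `Y` contains a co-`P₃`; `Y` is complete
multipartite with a nonedge; `Y` is a clique. In each case, avoiding all seven graphs would leave a
`(1, k)`-polar partition of `H`.

The listed graphs are themselves neither complete multipartite nor `(1, k)`-polar, so minimality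
forces the one found in `H` to be all of `H`. -/

@[simp] theorem join_adj_inl_inl {a b : V} : (G ⊕j H).Adj (.inl a) (.inl b) ↔ G.Adj a b := by
  simp [join]

@[simp] theorem join_adj_inr_inr {a b : W} : (G ⊕j H).Adj (.inr a) (.inr b) ↔ H.Adj a b := by
  simp [join]

@[simp] theorem join_adj_inl_inr {a : V} {b : W} : (G ⊕j H).Adj (.inl a) (.inr b) := by
  simp [join]

@[simp] theorem join_adj_inr_inl {a : W} {b : V} : (G ⊕j H).Adj (.inr a) (.inl b) := by
  simp [join]

theorem compl_sum : (G ⊕g H)ᶜ = Gᶜ ⊕j Hᶜ := by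
  ext (a | a) (b | b) <;> simp

end Adjacency

/-! ### Polarity as colouring -/

section Colorings

variable {V : Type u} {W : Type v} {G : SimpleGraph V} {H : SimpleGraph W} {k : ℕ}

/-- The vertices with a colour `some i` induce a cluster whose components are the colour classes. -/
def IsClusterColoring (G : SimpleGraph V) (f : V → Option (Fin k)) : Prop :=
  ∀ a b i j, f a = some i → f b = some j → a ≠ b → (G.Adj a b ↔ i = j)

/-- `(∞, k)`-polarity, with the cluster given by a colouring of its components. -/
def HasPolarColoring (k : ℕ) (G : SimpleGraph V) : Prop :=
  ∃ f : V → Option (Fin k), IsClusterColoring G f ∧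
    ∀ a b c, f a = none → f b = none → f c = none → ¬ G.Adj a b → ¬ G.Adj b c → ¬ G.Adj a c

/-- `(1, k)`-polarity, with the cluster given by a colouring of its components. -/
def HasMonopolarColoring (k : ℕ) (G : SimpleGraph V) : Prop :=
  ∃ f : V → Option (Fin k), IsClusterColoring G f ∧
    ∀ a b, f a = none → f b = none → ¬ G.Adj a b

theorem IsClusterColoring.comap {f : W → Option (Fin k)} (hf : IsClusterColoring H f)
    (φ : G ↪g H) : IsClusterColoring G (f ∘ φ) := fun a b i j ha hb hab => by
  rw [← φ.map_adj_iff]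
  exact hf _ _ i j ha hb (φ.injective.ne hab)

theorem HasPolarColoring.comap (h : HasPolarColoring k H) (φ : G ↪g H) : HasPolarColoring k G := by
  obtain ⟨f, hf, hn⟩ := h
  refine ⟨f ∘ φ, hf.comap φ, fun a b c ha hb hc => ?_⟩
  simpa using hn (φ a) (φ b) (φ c) ha hb hc

theorem HasMonopolarColoring.comap (h : HasMonopolarColoring k H) (φ : G ↪g H) :
    HasMonopolarColoring k G := by
  obtain ⟨f, hf, hn⟩ := h
  refine ⟨f ∘ φ, hf.comap φ, fun a b ha hb => ?_⟩
  simpa using hn (φ a) (φ b) ha hb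

theorem reachable_iff_of_compl_isCompleteMultipartite (h : Gᶜ.IsCompleteMultipartite) {a b : V} :
    G.Reachable a b ↔ a = b ∨ G.Adj a b := by
  constructor
  · intro hr
    obtain ⟨p⟩ := hr
    induction p with
    | nil => exact Or.inl rfl
    | @cons x y z hxy p ih =>
      have := h.trans x y z
      simp only [compl_adj, not_and, not_not] at this
      by_cases hxz : x = z
      · exact Or.inl hxz
      · refine Or.inr (this (fun _ => hxy) (fun hyz => ?_) hxz)
        exact ih.resolve_left hyz
  · rintro (rfl | h)
    · rfl
    · exact h.reachable

/-- Colours name cluster components and `none` marks the multipartite side. Some colours may go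
unused, which is why "at most `k` components" becomes an injection into `Fin k`. -/
theorem isPolar_top_iff : IsPolar ⊤ (k : ℕ∞) G ↔ HasPolarColoring k G := by
  classical
  constructor
  · rintro ⟨A, ⟨hA, -⟩, hB, hc⟩
    have hfin : Finite (G.induce Aᶜ).ConnectedComponent := by
      rw [← ENat.card_lt_top]
      exact hc.trans_lt (ENat.natCast_lt_top k)
    rw [ENat.card_eq_coe_natCard, Nat.cast_le] at hc
    let e := Finite.equivFin (G.induce Aᶜ).ConnectedComponent
    let g : (G.induce Aᶜ).ConnectedComponent ↪ Fin k :=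
      e.toEmbedding.trans (Fin.castLEEmb hc)
    refine ⟨fun v => if h : v ∈ A then none else
      some (g ((G.induce Aᶜ).connectedComponentMk ⟨v, h⟩)), ?_, ?_⟩
    · intro a b i j ha hb hab
      simp only at ha hb
      split_ifs at ha hb with h1 h2
      simp only [Option.some.injEq] at ha hb
      rw [← ha, ← hb, g.injective.eq_iff, ConnectedComponent.eq,
        reachable_iff_of_compl_isCompleteMultipartite hB]
      simp [hab]
    · intro a b c ha hb hc
      simp only [dite_eq_left_iff, reduceCtorEq, imp_false, not_not] at ha hb hc
      exact hA.trans ⟨a, ha⟩ ⟨b, hb⟩ ⟨c, hc⟩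
  · rintro ⟨f, hf, hn⟩
    have hsome : ∀ v : ({v | f v = none}ᶜ : Set V), ∃ i, f v = some i := fun v =>
      Option.ne_none_iff_exists'.1 v.2
    choose g hg using hsome
    have hadj : ∀ a b : ({v | f v = none}ᶜ : Set V), a ≠ b → (G.Adj a b ↔ g a = g b) :=
      fun a b hab => hf a b _ _ (hg a) (hg b) (Subtype.coe_ne_coe.2 hab)
    refine ⟨{v | f v = none}, ⟨⟨fun a b c => hn a b c a.2 b.2 c.2⟩, le_top⟩, ?_⟩
    have hcl : IsCluster (G.induce {v | f v = none}ᶜ) := by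
      refine ⟨fun a b c => ?_⟩
      simp only [compl_adj, comap_adj, Function.Embedding.subtype_apply, not_and, not_not]
      intro h1 h2 h3
      rw [hadj _ _ h3]
      by_cases hab : a = b
      · subst hab; exact (hadj _ _ h3).1 (h2 h3)
      · by_cases hbc : b = c
        · subst hbc; exact (hadj _ _ h3).1 (h1 h3)
        · exact ((hadj _ _ hab).1 (h1 hab)).trans ((hadj _ _ hbc).1 (h2 hbc))
    refine ⟨hcl, ?_⟩
    have : Function.Injective (fun C : (G.induce {v | f v = none}ᶜ).ConnectedComponent =>
        g C.out) := by
      intro C D hCD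
      rw [← Quot.out_eq C, ← Quot.out_eq D]
      refine ConnectedComponent.sound ?_
      rw [reachable_iff_of_compl_isCompleteMultipartite hcl]
      by_cases h : C.out = D.out
      · exact Or.inl h
      · exact Or.inr ((hadj _ _ h).2 hCD)
    simpa using ENat.card_le_card_of_injective this

/-- Besides `k` isolated vertices, only an independent set or everything else can be covered by
the complete multipartite part. -/
theorem hasPolarColoring_isolated_sum_iff :
    HasPolarColoring k (isolated k ⊕g H) ↔
      H.IsCompleteMultipartite ∨ HasMonopolarColoring k H := by
  constructor
  · rintro ⟨f, hf, hn⟩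
    by_cases hind : ∀ a b, f (.inr a) = none → f (.inr b) = none → ¬ H.Adj a b
    · exact Or.inr ⟨_, hf.comap (Embedding.sumInr (G := isolated k)), hind⟩
    · left
      push Not at hind
      obtain ⟨a, b, ha, hb, hab⟩ := hind
      -- An isolated vertex on the multipartite side would be nonadjacent to both ends of the edge
      -- `ab`.
      have hiso : ∀ i, f (.inl i) ≠ none := fun i hi => by
        simpa [hab] using hn (.inr a) (.inl i) (.inr b) ha hi hb
      choose g hg using fun i => Option.ne_none_iff_exists'.1 (hiso i)
      have hinj : Function.Injective g := fun i j hij => by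
        by_contra hne
        simpa [hij] using hf _ _ _ _ (hg i) (hg j) (by simpa using hne)
      -- All `k` colours are taken by isolated vertices, so no vertex of `H` can carry one.
      have hsurj := Finite.injective_iff_surjective.1 hinj
      have hnone : ∀ x, f (.inr x) = none := fun x => by
        by_contra hx
        obtain ⟨i, hi⟩ := Option.ne_none_iff_exists'.1 hx
        obtain ⟨j, rfl⟩ := hsurj i
        simpa using hf _ _ _ _ (hg j) hi (by simp)
      refine ⟨fun x y z h1 h2 => ?_⟩
      simpa [h1, h2] using hn (.inr x) (.inr y) (.inr z) (hnone x) (hnone y) (hnone z)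
  · rintro (h | ⟨f, hf, hn⟩)
    · refine ⟨Sum.elim some fun _ => none, ?_, ?_⟩
      · rintro (a | a) (b | b) i j ha hb hab <;> simp at ha hb hab ⊢
        rw [← ha, ← hb]; exact hab
      · rintro (a | a) (b | b) (c | c) ha hb hc h1 h2 <;> simp at ha hb hc h1 h2 ⊢
        exact h.trans _ _ _ h1 h2
    · refine ⟨Sum.elim (fun _ => none) f, ?_, ?_⟩
      · rintro (a | a) (b | b) i j ha hb hab <;> simp at ha hb hab ⊢
        exact hf _ _ _ _ ha hb hab
      · rintro (a | a) (b | b) (c | c) ha hb hc h1 h2 <;> simp at ha hb hc h1 h2 ⊢ <;>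
          exact hn _ _ ha hc

/-- The join is commutative up to isomorphism. -/
def joinComm : G ⊕j H ≃g H ⊕j G where
  toEquiv := Equiv.sumComm V W
  map_rel_iff' := by rintro (a | a) (b | b) <;> simp

/-- A coloured vertex of `G` is adjacent to every vertex of `H`, hence shares its colour with all of
them. So either `G` has no coloured vertex and is independent, or only one colour occurs: `H` is
complete and `G` is split. -/
theorem IsClusterColoring.of_join [Nonempty W] {f : V ⊕ W → Option (Fin k)}
    (hf : IsClusterColoring (G ⊕j H) f) (hn : ∀ a b, f a = none → f b = none → ¬ (G ⊕j H).Adj a b)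
    (hr : ∀ b, f (.inr b) ≠ none) :
    (HasMonopolarColoring 1 G ∧ H = ⊤) ∨
      (G = ⊥ ∧ ∃ g : W → Fin k, IsClusterColoring H (some ∘ g)) := by
  choose g hg using fun b => Option.ne_none_iff_exists'.1 (hr b)
  by_cases hl : ∀ a, f (.inl a) = none
  · right
    constructor
    · ext a b
      simpa using hn _ _ (hl a) (hl b)
    · refine ⟨g, fun a b i j ha hb hab => ?_⟩
      simpa using hf (.inr a) (.inr b) i j (by simpa [hg] using ha) (by simpa [hg] using hb)
        (by simpa using hab)
  · left
    have hcol : ∀ a i b, f (.inl a) = some i → i = g b := fun a i b ha => by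
      simpa using hf _ _ _ _ ha (hg b) (by simp)
    constructor
    · refine ⟨fun a => (f (.inl a)).map fun _ => 0, ?_, ?_⟩
      · intro a b i j ha hb hab
        obtain ⟨b₀⟩ := ‹Nonempty W›
        simp only [Option.map_eq_some_iff] at ha hb
        obtain ⟨i', ha, -⟩ := ha
        obtain ⟨j', hb, -⟩ := hb
        simpa [Subsingleton.elim i j, (hcol a i' b₀ ha).trans (hcol b j' b₀ hb).symm] using
          hf _ _ _ _ ha hb (by simpa using hab)
      · intro a b ha hb
        simpa using hn (.inl a) (.inl b) (by simpa using ha) (by simpa using hb)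
    · push Not at hl
      obtain ⟨a, ha⟩ := hl
      obtain ⟨i, hi⟩ := Option.ne_none_iff_exists'.1 ha
      ext b c
      rw [top_adj]
      refine ⟨fun h => h.ne, fun h => ?_⟩
      simpa [← hcol a i b hi, ← hcol a i c hi] using hf _ _ _ _ (hg b) (hg c) (by simpa using h)

/-- Monopolarity of a join: the independent set lies on one side. -/
theorem HasMonopolarColoring.of_join [Nonempty V] [Nonempty W]
    (h : HasMonopolarColoring k (G ⊕j H)) :
    ((HasMonopolarColoring 1 G ∧ H = ⊤) ∨
      (G = ⊥ ∧ ∃ f : W → Fin k, IsClusterColoring H (some ∘ f))) ∨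
    ((HasMonopolarColoring 1 H ∧ G = ⊤) ∨
      (H = ⊥ ∧ ∃ f : V → Fin k, IsClusterColoring G (some ∘ f))) := by
  obtain ⟨f, hf, hn⟩ := h
  by_cases hr : ∀ b, f (.inr b) ≠ none
  · exact Or.inl (hf.of_join hn hr)
  · push Not at hr
    obtain ⟨b, hb⟩ := hr
    refine Or.inr ((hf.comap (joinComm (G := H) (H := G)).toEmbedding).of_join ?_ ?_)
    · intro x y hx hy
      have := hn _ _ hx hy
      rwa [← Iso.map_adj_iff joinComm]
    · intro a ha
      exact hn (.inl a) (.inr b) ha hb join_adj_inl_inr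

end Colorings

/-! ### Assembling induced subgraphs from small pieces -/

section Embeddings

variable {V : Type u} {W : Type v} {X : Type w}
  {G : SimpleGraph V} {H : SimpleGraph W} {F : SimpleGraph X}

/-- Two embeddings whose images are completely joined give an embedding of the join. -/
def joinEmbedding (φ : G ↪g F) (ψ : H ↪g F) (h : ∀ x y, F.Adj (φ x) (ψ y)) : G ⊕j H ↪g F where
  toFun := Sum.elim φ ψ
  inj' := Sum.elim_injective.2 ⟨φ.injective, ψ.injective, fun x y => (h x y).ne⟩
  map_rel_iff' := by
    rintro (a | a) (b | b) <;> simp [h, (h _ _).symm]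

/-- Two embeddings with disjoint images and no edges between them give an embedding of the
disjoint union. -/
def sumEmbedding (φ : G ↪g F) (ψ : H ↪g F) (h : ∀ x y, φ x ≠ ψ y ∧ ¬ F.Adj (φ x) (ψ y)) :
    G ⊕g H ↪g F where
  toFun := Sum.elim φ ψ
  inj' := Sum.elim_injective.2 ⟨φ.injective, ψ.injective, fun x y => (h x y).1⟩
  map_rel_iff' := by
    rintro (a | a) (b | b) <;> simp [h, F.adj_comm (ψ _) (φ _)]

/-- An injective map that preserves and reflects adjacency, as an embedding. -/
def embeddingOfAdj (f : V → X) (hf : Function.Injective f)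
    (h : ∀ a b, F.Adj (f a) (f b) ↔ G.Adj a b) : G ↪g F :=
  ⟨⟨f, hf⟩, h _ _⟩

def singleEmbedding (a : X) : K 1 ↪g F :=
  embeddingOfAdj ![a] (Function.injective_of_subsingleton _)
    (by simp [Subsingleton.elim _ (0 : Fin 1)])

@[simp] theorem coe_singleEmbedding (a : X) : ⇑(singleEmbedding (F := F) a) = ![a] := rfl

def edgeEmbedding {a b : X} (h : F.Adj a b) : K 2 ↪g F :=
  embeddingOfAdj ![a, b]
    (by intro i j; fin_cases i <;> fin_cases j <;> simp [h.ne, h.ne'])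
    (by intro i j; fin_cases i <;> fin_cases j <;> simp [h, h.symm])

@[simp] theorem coe_edgeEmbedding {a b : X} (h : F.Adj a b) : ⇑(edgeEmbedding h) = ![a, b] := rfl

def nonedgeEmbedding {a b : X} (hne : a ≠ b) (h : ¬ F.Adj a b) : (K 2)ᶜ ↪g F :=
  embeddingOfAdj ![a, b]
    (by intro i j; fin_cases i <;> fin_cases j <;> simp [hne, hne.symm])
    (by intro i j; fin_cases i <;> fin_cases j <;> simp [h, F.adj_comm b a])

@[simp] theorem coe_nonedgeEmbedding {a b : X} (hne : a ≠ b) (h : ¬ F.Adj a b) :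
    ⇑(nonedgeEmbedding hne h) = ![a, b] := rfl

def pathEmbedding {a b c : X} (hab : F.Adj a b) (hbc : F.Adj b c) (hne : a ≠ c)
    (hac : ¬ F.Adj a c) : P₃ ↪g F :=
  embeddingOfAdj ![a, b, c]
    (by
      intro i j; fin_cases i <;> fin_cases j <;>
        simp [hab.ne, hab.ne', hbc.ne, hbc.ne', hne, hne.symm])
    (by
      intro i j; fin_cases i <;> fin_cases j <;>
        simp [pathGraph_adj, hab, hab.symm, hbc, hbc.symm, hac, F.adj_comm c a])

@[simp] theorem coe_pathEmbedding {a b c : X} (hab : F.Adj a b) (hbc : F.Adj b c) (hne : a ≠ c)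
    (hac : ¬ F.Adj a c) : ⇑(pathEmbedding hab hbc hne hac) = ![a, b, c] := rfl

def coPathEmbedding {a b c : X} (hab : ¬ F.Adj a b) (hbc : ¬ F.Adj b c) (hac : F.Adj a c) :
    P₃ᶜ ↪g F :=
  embeddingOfAdj ![a, b, c]
    (by
      have h1 : a ≠ b := by rintro rfl; exact hbc hac
      have h2 : b ≠ c := by rintro rfl; exact hab hac
      intro i j; fin_cases i <;> fin_cases j <;>
        simp [h1, h1.symm, h2, h2.symm, hac.ne, hac.ne'])
    (by
      intro i j; fin_cases i <;> fin_cases j <;>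
        simp [pathGraph_adj, hab, F.adj_comm b a, hbc, F.adj_comm c b, hac, hac.symm])

@[simp] theorem coe_coPathEmbedding {a b c : X} (hab : ¬ F.Adj a b) (hbc : ¬ F.Adj b c)
    (hac : F.Adj a c) : ⇑(coPathEmbedding hab hbc hac) = ![a, b, c] := rfl

theorem C₄_adj {i j : Fin 4} : C₄.Adj i j ↔ i + 1 = j ∨ j + 1 = i := by
  revert i j; decide

def cycleEmbedding {a b c d : X} (hab : F.Adj a b) (hbc : F.Adj b c) (hcd : F.Adj c d)
    (hda : F.Adj d a) (hac : a ≠ c) (hbd : b ≠ d) (nac : ¬ F.Adj a c) (nbd : ¬ F.Adj b d) :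
    C₄ ↪g F :=
  embeddingOfAdj ![a, b, c, d]
    (by
      intro i j; fin_cases i <;> fin_cases j <;>
        simp [hab.ne, hab.ne', hbc.ne, hbc.ne', hcd.ne, hcd.ne', hda.ne, hda.ne', hac, hac.symm,
          hbd, hbd.symm])
    (by
      intro i j
      rw [C₄_adj]
      fin_cases i <;> fin_cases j <;>
        simp [hab, hab.symm, hbc, hbc.symm, hcd, hcd.symm, hda, hda.symm, nac, nbd,
          F.adj_comm c a, F.adj_comm d b])

@[simp] theorem coe_cycleEmbedding {a b c d : X} (hab : F.Adj a b) (hbc : F.Adj b c)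
    (hcd : F.Adj c d) (hda : F.Adj d a) (hac : a ≠ c) (hbd : b ≠ d) (nac : ¬ F.Adj a c)
    (nbd : ¬ F.Adj b d) :
    ⇑(cycleEmbedding hab hbc hcd hda hac hbd nac nbd) = ![a, b, c, d] := rfl

end Embeddings

/-! ### The structural property of cographs -/

section Separable

variable {V : Type u} {W : Type v} {G : SimpleGraph V} {H : SimpleGraph W}

/-- `T` splits `S` into two nonempty parts that are completely joined or have no edge between
them. -/
def IsSeparation (G : SimpleGraph V) (S T : Set V) : Prop :=
  T ⊆ S ∧ T.Nonempty ∧ (S \ T).Nonempty ∧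
    ((∀ a ∈ T, ∀ b ∈ S \ T, G.Adj a b) ∨ ∀ a ∈ T, ∀ b ∈ S \ T, ¬ G.Adj a b)

/-- Every set of at least two vertices induces a disjoint union or a join. -/
def IsSeparable (G : SimpleGraph V) : Prop :=
  ∀ S : Set V, S.Nontrivial → ∃ T, IsSeparation G S T

theorem IsSeparation.image {S T : Set V} (h : IsSeparation G S T) (φ : G ↪g H) :
    IsSeparation H (φ '' S) (φ '' T) := by
  obtain ⟨h1, h2, h3, h4⟩ := h
  rw [IsSeparation, ← Set.image_sdiff φ.injective]
  refine ⟨Set.image_mono h1, h2.image _, h3.image _, ?_⟩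
  simpa only [Set.forall_mem_image, φ.map_adj_iff] using h4

theorem IsSeparable.exists_of_subset_range (h : IsSeparable G) (φ : G ↪g H) {S : Set W}
    (hS : S.Nontrivial) (hφ : S ⊆ Set.range φ) : ∃ T, IsSeparation H S T := by
  obtain ⟨S, rfl⟩ := Set.subset_range_iff_exists_image_eq.1 hφ
  obtain ⟨T, hT⟩ := h S (Set.nontrivial_of_image φ S hS)
  exact ⟨_, hT.image φ⟩

theorem IsSeparable.comap (h : IsSeparable H) (φ : G ↪g H) : IsSeparable G := by
  intro S hS
  obtain ⟨T, h1, h2, h3, h4⟩ := h _ (hS.image φ.injective)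
  obtain ⟨T, rfl⟩ := Set.subset_range_iff_exists_image_eq.1 (h1.trans (Set.image_subset_range _ _))
  rw [← Set.image_sdiff φ.injective] at h3 h4
  refine ⟨T, (Set.image_subset_image_iff φ.injective).1 h1, h2.of_image, h3.of_image, ?_⟩
  simpa only [Set.forall_mem_image, φ.map_adj_iff] using h4

theorem IsSeparable.sum (hG : IsSeparable G) (hH : IsSeparable H) : IsSeparable (G ⊕g H) := by
  intro S hS
  by_cases hl : S ⊆ Set.range Sum.inl
  · exact hG.exists_of_subset_range Embedding.sumInl hS hl
  by_cases hr : S ⊆ Set.range Sum.inr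
  · exact hH.exists_of_subset_range Embedding.sumInr hS hr
  rw [Set.not_subset] at hl hr
  obtain ⟨x | x, hx, hx'⟩ := hl
  · simp at hx'
  obtain ⟨y | y, hy, hy'⟩ := hr
  swap
  · simp at hy'
  refine ⟨S ∩ Set.range Sum.inl, Set.inter_subset_left, ⟨_, hy, by simp⟩, ⟨_, hx, by simp⟩,
    Or.inr ?_⟩
  rintro (a | a) ha (b | b) hb <;> simp_all

/-- Complementation swaps the two kinds of split. Separability visibly passes to induced subgraphs,
unlike the inductive definition, and it is all that the search for a listed graph uses about
cographs. -/
theorem IsCograph.isSeparable {V : Type u} {G : SimpleGraph V} (h : IsCograph G) :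
    IsSeparable G := by
  induction h with
  | single G => exact fun S hS => (hS.not_subsingleton Set.subsingleton_of_subsingleton).elim
  | compl G _ ih =>
    intro S hS
    obtain ⟨T, h1, h2, h3, h4⟩ := ih S hS
    refine ⟨T, h1, h2, h3, h4.symm.imp (fun h a ha b hb => ?_) fun h a ha b hb => ?_⟩
    · rw [compl_adj]
      exact ⟨fun hab => hb.2 (hab ▸ ha), h a ha b hb⟩
    · rw [compl_adj]
      exact fun h' => h'.2 (h a ha b hb)
  | disjUnion G H _ _ ihG ihH => exact ihG.sum ihH
  | iso G H e _ ih => exact ih.comap e.symm.toEmbedding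

theorem mem_of_reachable {T : Set V} (hT : ∀ a ∈ T, ∀ b ∉ T, ¬ G.Adj a b) {a b : V}
    (h : G.Reachable a b) (ha : a ∈ T) : b ∈ T := by
  obtain ⟨p⟩ := h
  induction p with
  | nil => exact ha
  | cons hxy _ ih => exact ih (by_contra fun hy => hT _ ha _ hy hxy)

/-- A component of the complement with at least two vertices induces a disjoint union. -/
theorem IsSeparable.exists_not_adj (hG : IsSeparable G) {u a : V} (ha : Gᶜ.Adj u a) :
    ∃ T : Set V, T.Nonempty ∧ (∃ b, b ∉ T ∧ Gᶜ.Reachable u b) ∧ (∀ x ∈ T, Gᶜ.Reachable u x) ∧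
      ∀ x ∈ T, ∀ y ∉ T, Gᶜ.Reachable u y → ¬ G.Adj x y := by
  obtain ⟨T, h1, ⟨x, hx⟩, ⟨y, hy, hy'⟩, h4⟩ :=
    hG {x | Gᶜ.Reachable u x} ⟨u, Reachable.refl u, a, ha.reachable, ha.ne⟩
  refine ⟨T, ⟨x, hx⟩, ⟨y, hy', hy⟩, h1, ?_⟩
  -- If the split were a join, no complement edge would leave `T`, contradicting that the set is one
  -- component of the complement.
  rcases h4 with h4 | h4
  · refine (hy' (mem_of_reachable (G := Gᶜ) (fun a ha b hb hab => ?_)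
      ((Reachable.symm (h1 hx)).trans hy) hx)).elim
    exact hab.2 (h4 a ha b ⟨Reachable.trans (h1 ha) hab.reachable, hb⟩)
  · exact fun x hx y hy hy' => h4 x hx y ⟨hy', hy⟩

/-- A split of the whole vertex set without crossing edges would disconnect `G`; so the split is a
join, and the complement is disconnected. -/
theorem IsSeparable.exists_not_reachable_compl (hG : IsSeparable G) (hc : G.Connected)
    [Nontrivial V] (u : V) : ∃ b, ¬ Gᶜ.Reachable u b := by
  obtain ⟨T, -, ⟨x, hx⟩, ⟨y, -, hy'⟩, h4⟩ := hG Set.univ Set.nontrivial_univ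
  have h4 := h4.resolve_right fun h => hy' <|
    mem_of_reachable (fun a ha b hb => h a ha b ⟨trivial, hb⟩) (hc.preconnected x y) hx
  by_contra! h
  exact hy' (mem_of_reachable (G := Gᶜ) (fun a ha b hb hab => hab.2 (h4 a ha b ⟨trivial, hb⟩))
      ((h x).symm.trans (h y)) hx)

end Separable

/-! ### Independent set outside `X` -/

section Structure

variable {W : Type u} [Finite W] {H : SimpleGraph W} {k : ℕ} {X : Set W}

/-- `X` and its complement are completely joined in `H`. -/
def IsJoinPart (H : SimpleGraph W) (X : Set W) : Prop := ∀ x ∈ X, ∀ y ∉ X, H.Adj x y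

/-- Here `X` induces a cluster. With at most `k` components, it and the independent outside would
form a monopolar partition. So there are at least `k` components besides that of the edge `ab`; one
vertex from each gives `K₂ + kK₁`, joined to the nonedge outside. -/
theorem exists_embedding_of_independent_outside (hX : IsJoinPart H X)
    (hm : ¬ HasMonopolarColoring k H) {y y' : W} (hy : y ∉ X) (hy' : y' ∉ X) (hyy : y ≠ y')
    (hY : ∀ x ∉ X, ∀ y ∉ X, ¬ H.Adj x y) {a b : W} (ha : a ∈ X) (hb : b ∈ X) (hab : H.Adj a b)
    (hP : ∀ a ∈ X, ∀ b ∈ X, ∀ c ∈ X, H.Adj a b → H.Adj b c → a ≠ c → H.Adj a c) :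
    Nonempty ((K 2)ᶜ ⊕j (K 2 ⊕g isolated k) ↪g H) := by
  classical
  have hcl : (H.induce X)ᶜ.IsCompleteMultipartite := by
    refine ⟨fun x y z => ?_⟩
    simp only [compl_adj, comap_adj, Function.Embedding.subtype_apply, not_and, not_not]
    intro h1 h2 h3
    by_cases hxy : x = y
    · exact hxy ▸ h2 (hxy ▸ h3)
    by_cases hyz : y = z
    · exact hyz ▸ h1 (hyz ▸ h3)
    exact hP x x.2 y y.2 z z.2 (h1 hxy) (h2 hyz) (Subtype.coe_ne_coe.2 h3)
  have hr : ∀ x y : X, (H.induce X).connectedComponentMk x = (H.induce X).connectedComponentMk y ↔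
      x = y ∨ H.Adj x y := fun x y => by
    rw [ConnectedComponent.eq, reachable_iff_of_compl_isCompleteMultipartite hcl]
    simp
  let c₀ := (H.induce X).connectedComponentMk ⟨a, ha⟩
  by_cases hcard : Nat.card (H.induce X).ConnectedComponent ≤ k
  · refine (hm ?_).elim
    let g : (H.induce X).ConnectedComponent ↪ Fin k :=
      (Finite.equivFin _).toEmbedding.trans (Fin.castLEEmb hcard)
    refine ⟨fun x => if h : x ∈ X then some (g ((H.induce X).connectedComponentMk ⟨x, h⟩))
      else none, ?_, ?_⟩
    · intro x y i j hx hy hxy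
      simp only at hx hy
      split_ifs at hx hy
      simp only [Option.some.injEq] at hx hy
      rw [← hx, ← hy, g.injective.eq_iff, hr]
      simp [hxy]
    · intro x y hx hy
      simp only [dite_eq_right_iff, reduceCtorEq, imp_false] at hx hy
      exact hY x hx y hy
  · have h2 : Nat.card (Fin k) ≤ Nat.card {c : (H.induce X).ConnectedComponent // c ≠ c₀} := by
      have := Set.ncard_add_ncard_compl {c₀}
      rw [Set.ncard_singleton] at this
      change _ ≤ Set.ncard ({c₀}ᶜ : Set _)
      rw [Nat.card_fin]
      omega
    let r := (Finite.equivFin (Fin k)).toEmbedding.trans <| (Fin.castLEEmb h2).trans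
      (Finite.equivFin {c : (H.induce X).ConnectedComponent // c ≠ c₀}).symm.toEmbedding
    have hout : ∀ c : (H.induce X).ConnectedComponent,
      (H.induce X).connectedComponentMk c.out = c := fun c => Quot.out_eq c
    have hrne : ∀ i j, i ≠ j → (r i).1.out.1 ≠ (r j).1.out.1 ∧
        ¬ H.Adj (r i).1.out.1 (r j).1.out.1 := fun i j hij => by
      have := (hr (r i).1.out (r j).1.out).not.1
        (by rw [hout, hout]; simpa [Subtype.coe_inj] using hij)
      rw [not_or] at this
      exact ⟨Subtype.coe_ne_coe.2 this.1, this.2⟩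
    have hra : ∀ i, ∀ x (hx : x ∈ X), (H.induce X).connectedComponentMk ⟨x, hx⟩ = c₀ →
        x ≠ (r i).1.out.1 ∧ ¬ H.Adj x (r i).1.out.1 := fun i x hx hxc => by
      have := (hr ⟨x, hx⟩ (r i).1.out).not.1
        (by rw [hout, hxc]; exact (r i).2.symm)
      rw [not_or] at this
      exact ⟨fun h => this.1 (Subtype.ext h), this.2⟩
    let ρ : isolated k ↪g H := embeddingOfAdj (fun i => (r i).1.out.1)
      (fun i j hij => by_contra fun hne => (hrne i j hne).1 hij)
      (fun i j => by
        by_cases hij : i = j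
        · simp [hij]
        · simpa using (hrne i j hij).2)
    have hρ : ∀ i, ρ i = (r i).1.out.1 := fun i => rfl
    have hs : ∀ i j, edgeEmbedding hab i ≠ ρ j ∧ ¬ H.Adj (edgeEmbedding hab i) (ρ j) := by
      intro i j
      rw [hρ]
      fin_cases i
      · exact hra j a ha rfl
      · exact hra j b hb ((hr _ _).2 (Or.inr hab.symm))
    have hmem : ∀ x, sumEmbedding (edgeEmbedding hab) ρ hs x ∈ X := by
      rintro (i | i)
      · fin_cases i
        · exact ha
        · exact hb
      · exact (r i).1.out.2
    refine ⟨joinEmbedding (nonedgeEmbedding hyy (hY y hy y' hy'))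
      (sumEmbedding (edgeEmbedding hab) ρ hs) ?_⟩
    intro i x
    fin_cases i
    · exact (hX _ (hmem x) y hy).symm
    · exact (hX _ (hmem x) y' hy').symm

end Structure

/-! ### Finding a listed graph -/

section Structure

variable {W : Type u} {H : SimpleGraph W} {k : ℕ}

/-- `H` contains one of the listed graphs as an induced subgraph. -/
def ContainsListed (k : ℕ) (H : SimpleGraph W) : Prop :=
  ∃ (X : Type) (F : SimpleGraph X), InList k F ∧ Nonempty (F ↪g H)

/-- A split graph is monopolar. -/
theorem hasMonopolarColoring_of_split (hk : 1 ≤ k) (A : Set W)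
    (hA : ∀ x ∈ A, ∀ y ∈ A, ¬ H.Adj x y) (hB : ∀ x ∉ A, ∀ y ∉ A, x ≠ y → H.Adj x y) :
    HasMonopolarColoring k H := by
  classical
  refine ⟨fun x => if x ∈ A then none else some ⟨0, hk⟩, fun x y i j hx hy hxy => ?_,
    fun x y hx hy => ?_⟩
  · simp only at hx hy
    split_ifs at hx hy with h1 h2
    simp only [Option.some.injEq] at hx hy
    simp [← hx, ← hy, hB x h1 y h2 hxy]
  · simp only [ite_eq_left_iff, reduceCtorEq, imp_false, not_not] at hx hy
    exact hA x hx y hy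

/-- The last case of the search: `X₁` is complete multipartite, `X₂` and the outside are cliques. If
`X₂` is a single vertex and `X₁` is split, `H` is split; if `X₁` is a clique and the outside is a
single vertex, that vertex is the independent set and `X₁`, `X₂` are the clusters. Each way of
missing both yields a listed graph. -/
theorem containsListed_of_clique_outside (hk : 2 ≤ k) {X₁ X₂ : Set W} (hX : IsJoinPart H (X₁ ∪ X₂))
    (hd : ∀ x ∈ X₁, x ∉ X₂) (h₁₂ : ∀ x ∈ X₁, ∀ y ∈ X₂, ¬ H.Adj x y) (h₂ : X₂.Nonempty)
    {a b : W} (ha : a ∈ X₁) (hb : b ∈ X₁) (hab : H.Adj a b)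
    (hm : ∀ x ∈ X₁, ∀ y ∈ X₁, ∀ z ∈ X₁, ¬ H.Adj x y → ¬ H.Adj y z → ¬ H.Adj x z)
    (hc : ∀ x ∈ X₂, ∀ y ∈ X₂, x ≠ y → H.Adj x y)
    (hY : ∀ x ∉ X₁ ∪ X₂, ∀ y ∉ X₁ ∪ X₂, x ≠ y → H.Adj x y) {y : W} (hy : y ∉ X₁ ∪ X₂)
    (hp : ¬ HasMonopolarColoring k H) : ContainsListed k H := by
  classical
  obtain ⟨c, hc₂⟩ := h₂
  have hj₁ : ∀ x ∈ X₁, ∀ y ∉ X₁ ∪ X₂, H.Adj x y := fun x hx y hy => hX x (Or.inl hx) y hy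
  have hj₂ : ∀ x ∈ X₂, ∀ y ∉ X₁ ∪ X₂, H.Adj x y := fun x hx y hy => hX x (Or.inr hx) y hy
  have hne : ∀ x ∈ X₁, ∀ y ∈ X₂, x ≠ y := fun x hx y hy h => hd x hx (h ▸ hy)
  by_cases hq : ∀ x ∈ X₁, ∀ y ∈ X₁, x ≠ y → H.Adj x y
  · by_cases hs : X₂.Subsingleton
    · refine (hp <| hasMonopolarColoring_of_split (by omega) X₂ (fun x hx y hy => ?_)
        fun x hx y hy hxy => ?_).elim
      · rw [hs hx hy]; exact H.loopless.irrefl _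
      · by_cases hx₁ : x ∈ X₁ <;> by_cases hy₁ : y ∈ X₁
        · exact hq x hx₁ y hy₁ hxy
        · exact hj₁ x hx₁ y (by simp [hy, hy₁])
        · exact (hj₁ y hy₁ x (by simp [hx, hx₁])).symm
        · exact hY x (by simp [hx, hx₁]) y (by simp [hy, hy₁]) hxy
    rw [Set.not_subsingleton_iff] at hs
    obtain ⟨c, hc₂, d, hd₂, hcd⟩ := hs
    by_cases hs : ∃ y' ∉ X₁ ∪ X₂, y ≠ y'
    · obtain ⟨y', hy', hyy⟩ := hs
      refine ⟨_, _, Or.inr <| Or.inr <| Or.inl ⟨Iso.refl⟩, ⟨joinEmbedding (sumEmbedding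
        (edgeEmbedding hab) (edgeEmbedding (hc c hc₂ d hd₂ hcd)) ?_)
        (edgeEmbedding (hY y hy y' hy' hyy)) ?_⟩⟩
      · simp [Fin.forall_fin_two, *]
      · simp [sumEmbedding, Sum.forall, Fin.forall_fin_two, *]
    · push Not at hs
      refine (hp ?_).elim
      -- Two clusters are needed here, whence `2 ≤ k`.
      refine ⟨fun x => if x ∈ X₁ then some ⟨0, by omega⟩ else if x ∈ X₂ then some ⟨1, by omega⟩
        else none, fun x y i j hx hy hxy => ?_, fun x y hx hy => ?_⟩
      · simp only at hx hy
        split_ifs at hx hy with h1 h2 h3 h4 h5 h6 <;>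
          simp only [Option.some.injEq] at hx hy <;> simp only [← hx, ← hy]
        · simp [hq x h1 y h2 hxy]
        · simp [h₁₂ x h1 y h3]
        · simp [H.adj_comm x y, h₁₂ y h5 x h4]
        · simp [hc x h4 y h6 hxy]
      · simp only at hx hy
        split_ifs at hx hy with h1 h2 h3 h4
        rw [← hs x (by simp [*]), ← hs y (by simp [*])]
        exact H.loopless.irrefl _
  · push Not at hq
    obtain ⟨p, hp₁, p', hp₁', hpp, hn⟩ := hq
    -- Otherwise `p` would be nonadjacent to both ends of the edge `ab`, impossible in a complete
    -- multipartite graph.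
    obtain ⟨q, hq₁, hpq⟩ : ∃ q ∈ X₁, H.Adj p q := by
      by_contra! h
      exact hm a ha p hp₁ b hb (fun h' => h a ha h'.symm) (h b hb) hab
    have hadj : ∀ q ∈ X₁, H.Adj p q → H.Adj q p' := fun q hq₁ hpq => by
      by_contra h
      exact hm p hp₁ p' hp₁' q hq₁ hn (fun h' => h h'.symm) hpq
    by_cases h4 : ∃ r ∈ X₁, ∃ s ∈ X₁, H.Adj p r ∧ H.Adj p s ∧ r ≠ s ∧ ¬ H.Adj r s
    · obtain ⟨r, hr, s, hs, hpr, hps, hrs, hn'⟩ := h4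
      refine ⟨_, _, Or.inr <| Or.inr <| Or.inr <| Or.inl ⟨Iso.refl⟩, ⟨joinEmbedding
        (singleEmbedding y) (sumEmbedding (cycleEmbedding hpr (hadj r hr hpr) (hadj s hs hps).symm
        hps.symm hpp hrs hn hn') (singleEmbedding c) ?_) ?_⟩⟩
      · simp [Fin.forall_fin_succ, *]
      · simp [sumEmbedding, Sum.forall, Fin.forall_fin_succ, H.adj_comm y, *]
    push Not at h4
    by_cases hs : X₂.Subsingleton
    -- The part of `p` in `X₁`, with the single vertex of `X₂`, is independent; the neighbours of
    -- `p` in `X₁`, with the outside, form a clique.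
    · refine (hp <| hasMonopolarColoring_of_split (by omega)
        (X₂ ∪ {x | x ∈ X₁ ∧ ¬ H.Adj x p}) ?_ fun x hx y hy hxy => ?_).elim
      · rintro x (hx | ⟨hx, hx'⟩) y (hy | ⟨hy, hy'⟩)
        · rw [hs hx hy]; exact H.loopless.irrefl _
        · exact fun h => h₁₂ y hy x hx h.symm
        · exact h₁₂ x hx y hy
        · exact hm x hx p hp₁ y hy hx' fun h => hy' h.symm
      · simp only [Set.mem_union, Set.mem_ofPred_eq, not_or, not_and, not_not] at hx hy
        by_cases hx₁ : x ∈ X₁ <;> by_cases hy₁ : y ∈ X₁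
        · exact h4 x hx₁ y hy₁ (hx.2 hx₁).symm (hy.2 hy₁).symm hxy
        · exact hj₁ x hx₁ y (by simp [hy, hy₁])
        · exact (hj₁ y hy₁ x (by simp [hx, hx₁])).symm
        · exact hY x (by simp [hx, hx₁]) y (by simp [hy, hy₁]) hxy
    rw [Set.not_subsingleton_iff] at hs
    obtain ⟨c, hc₂, d, hd₂, hcd⟩ := hs
    refine ⟨_, _, Or.inr <| Or.inl ⟨Iso.refl⟩, ⟨joinEmbedding (sumEmbedding
      (pathEmbedding hpq (hadj q hq₁ hpq) hpp hn) (edgeEmbedding (hc c hc₂ d hd₂ hcd)) ?_)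
      (singleEmbedding y) ?_⟩⟩
    · simp [Fin.forall_fin_succ, *]
    · simp [sumEmbedding, Sum.forall, Fin.forall_fin_succ, *]

/-- A connected graph built by joins and disjoint unions that is `(∞, 1)`-polar, but neither
complete multipartite nor `(1, k)`-polar, contains one of the listed graphs. -/
theorem containsListed [Finite W] [Nontrivial W] (hk : 2 ≤ k) (hs : IsSeparable H)
    (hc : H.Connected) (hm : ¬ H.IsCompleteMultipartite) (hp : ¬ HasMonopolarColoring k H)
    (h₁ : HasPolarColoring 1 H) : ContainsListed k H := by
  classical
  obtain ⟨u, a, b, hu⟩ := exists_isPathGraph3Compl_of_not_isCompleteMultipartite hm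
  have hab : H.Adj a b := hu.adj
  have hua : ¬ H.Adj u a := hu.not_adj_fst
  have hub : ¬ H.Adj u b := hu.not_adj_snd
  have hua' : Hᶜ.Adj u a := ⟨hu.ne_fst, hua⟩
  have hub' : Hᶜ.Adj u b := ⟨hu.ne_snd, hub⟩
  obtain ⟨y, hy⟩ := hs.exists_not_reachable_compl hc u
  obtain ⟨T, ⟨t, ht⟩, ⟨z, hz, hz'⟩, hTX, hT⟩ := hs.exists_not_adj hua'
  let X : Set W := {x | Hᶜ.Reachable u x}
  have hX : IsJoinPart H X := fun x hx y hy => by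
    by_contra h
    exact hy (Reachable.trans hx (Adj.reachable (G := Hᶜ) ⟨fun h => hy (h ▸ hx), h⟩))
  have huX : u ∈ X := Reachable.refl u
  have haX : a ∈ X := hua'.reachable
  have hbX : b ∈ X := hub'.reachable
  have hXY : ∀ x ∈ X, ∀ y ∉ X, x ≠ y := fun x hx y hy h => hy (h ▸ hx)
  by_cases hY : ∃ c ∉ X, ∃ d ∉ X, ∃ e ∉ X, ¬ H.Adj c d ∧ ¬ H.Adj d e ∧ H.Adj c e
  · obtain ⟨c, hcX, d, hdX, e, heX, hcd, hde, hce⟩ := hY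
    refine ⟨_, (P₃ ⊕g P₃)ᶜ, Or.inl ⟨Iso.refl⟩, ?_⟩
    rw [compl_sum]
    refine ⟨joinEmbedding (coPathEmbedding (fun h => hua h.symm) hub hab)
      (coPathEmbedding hcd hde hce) ?_⟩
    have := hX a haX
    have := hX u huX
    have := hX b hbX
    simp [Fin.forall_fin_succ, *]
  push Not at hY
  by_cases hq : ∃ y ∉ X, ∃ y' ∉ X, y ≠ y' ∧ ¬ H.Adj y y'
  · obtain ⟨y, hy, y', hy', hyy, hn⟩ := hq
    by_cases hz : ∃ z ∉ X, H.Adj z y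
    · obtain ⟨z, hz, hzy⟩ := hz
      have hzy' : H.Adj z y' := by
        by_contra h
        exact hY y hy y' hy' z hz hn (fun h' => h h'.symm) hzy.symm
      refine ⟨_, K 1 ⊕j (P₃ ⊕g K 2)ᶜ, Or.inr <| Or.inr <| Or.inr <| Or.inr <| Or.inl ⟨Iso.refl⟩,
        ?_⟩
      rw [compl_sum]
      refine ⟨joinEmbedding (singleEmbedding z) (joinEmbedding
        (coPathEmbedding (fun h => hua h.symm) hub hab) (nonedgeEmbedding hyy hn) ?_) ?_⟩
      · have := hX a haX
        have := hX u huX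
        have := hX b hbX
        simp [Fin.forall_fin_succ, *]
      · have := fun x hx => (hX x hx z hz).symm
        simp [joinEmbedding, Sum.forall, Fin.forall_fin_succ, *]
    push Not at hz
    have hind : ∀ x ∉ X, ∀ x' ∉ X, ¬ H.Adj x x' := fun x hx x' hx' =>
      hY x hx y hy x' hx' (hz x hx) fun h => hz x' hx' h.symm
    by_cases h3 : ∀ a ∈ X, ∀ b ∈ X, ∀ c ∈ X, H.Adj a b → H.Adj b c → a ≠ c → H.Adj a c
    · exact ⟨_, _, Or.inr <| Or.inr <| Or.inr <| Or.inr <| Or.inr <| Or.inr ⟨Iso.refl⟩,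
        exists_embedding_of_independent_outside hX hp hy hy' hyy hind haX hbX hab h3⟩
    push Not at h3
    obtain ⟨a, haX, b, hbX, c, hcX, hab, hbc, hac, hn'⟩ := h3
    have hside : ∀ x ∈ X, ∀ y ∈ X, H.Adj x y → (x ∈ T ↔ y ∈ T) := fun x hx y hy hxy =>
      ⟨fun h => by_contra fun h' => hT x h y h' hy hxy,
        fun h => by_contra fun h' => hT y h x h' hx hxy.symm⟩
    -- The path stays on one side of `T`; `w` is a vertex of `X` on the other side.
    obtain ⟨w, hw, hfar⟩ : ∃ w ∈ X, ∀ x ∈ X, (x ∈ T ↔ b ∈ T) → x ≠ w ∧ ¬ H.Adj x w := by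
      by_cases hbT : b ∈ T
      · refine ⟨z, hz', fun x hx h => ?_⟩
        have hxT := h.2 hbT
        exact ⟨fun h => ‹z ∉ T› (h ▸ hxT), hT x hxT z ‹_› hz'⟩
      · refine ⟨t, hTX t ht, fun x hx h => ?_⟩
        have hxT := h.not.2 hbT
        exact ⟨fun h => hxT (h ▸ ht), fun h => hT t ht x hxT hx h.symm⟩
    have ha := hfar a haX (hside a haX b hbX hab)
    have hb := hfar b hbX Iff.rfl
    have hc := hfar c hcX (hside b hbX c hcX hbc).symm
    refine ⟨_, _, Or.inr <| Or.inr <| Or.inr <| Or.inr <| Or.inr <| Or.inl ⟨Iso.refl⟩,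
      ⟨joinEmbedding (nonedgeEmbedding hyy hn) (sumEmbedding (pathEmbedding hab hbc hac hn')
      (singleEmbedding w) ?_) ?_⟩⟩
    · simp [Fin.forall_fin_succ, *]
    · have := fun x hx => (hX x hx y hy).symm
      have := fun x hx => (hX x hx y' hy').symm
      simp [sumEmbedding, Sum.forall, Fin.forall_fin_succ, *]
  push Not at hq
  obtain ⟨f, hf, hn⟩ := h₁
  have hsome : ∀ x y, f x ≠ none → f y ≠ none → x ≠ y → H.Adj x y := fun x y hx hy hxy => by
    obtain ⟨i, hi⟩ := Option.ne_none_iff_exists'.1 hx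
    obtain ⟨j, hj⟩ := Option.ne_none_iff_exists'.1 hy
    exact (hf x y i j hi hj hxy).2 (Subsingleton.elim _ _)
  -- If the multipartite side met `X` in an independent set, that set and the remaining clique would
  -- show that `H` is split.
  obtain ⟨c, hcX, d, hdX, hfc, hfd, hcd⟩ : ∃ c ∈ X, ∃ d ∈ X, f c = none ∧ f d = none ∧
      H.Adj c d := by
    by_contra! h
    refine hp (hasMonopolarColoring_of_split (by omega) {x | x ∈ X ∧ f x = none}
      (fun x hx y hy => h x hx.1 y hy.1 hx.2 hy.2) fun x hx y hy hxy => ?_)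
    simp only [Set.mem_ofPred_eq, not_and] at hx hy
    by_cases hxX : x ∈ X <;> by_cases hyX : y ∈ X
    · exact hsome x y (hx hxX) (hy hyX) hxy
    · exact hX x hxX y hyX
    · exact (hX y hyX x hxX).symm
    · exact hq x hxX y hyX hxy
  -- `X₁` is the side of `T` containing the edge `cd`. A vertex of `X₂` on the multipartite side
  -- would form a co-`P₃` with `cd`, so `X₂` lies in the clique; then `X₁`, having no edge to `X₂`,
  -- avoids the clique.
  have key : ∀ X₁ X₂ : Set W, X₁ ∪ X₂ = X → (∀ x ∈ X₁, x ∉ X₂) → X₂.Nonempty →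
      (∀ x ∈ X₁, ∀ y ∈ X₂, ¬ H.Adj x y) → c ∈ X₁ → d ∈ X₁ → ContainsListed k H := by
    intro X₁ X₂ hU hd h₂ h₁₂ hc₁ hd₁
    have hX₂ : ∀ x ∈ X₂, f x ≠ none := fun x hx h =>
      hn c x d hfc h hfd (h₁₂ c hc₁ x hx) (fun h => h₁₂ d hd₁ x hx h.symm) hcd
    have hX₁ : ∀ x ∈ X₁, f x = none := fun x hx => by
      by_contra h
      obtain ⟨y, hy⟩ := h₂
      exact h₁₂ x hx y hy (hsome x y h (hX₂ y hy) fun h => hd x hx (h ▸ hy))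
    refine containsListed_of_clique_outside hk (hU ▸ hX) hd h₁₂ h₂ hc₁ hd₁ hcd
      (fun x hx y hy z hz => hn x y z (hX₁ x hx) (hX₁ y hy) (hX₁ z hz))
      (fun x hx y hy => hsome x y (hX₂ x hx) (hX₂ y hy)) (by simpa only [hU] using hq)
      (y := y) (by rw [hU]; exact hy) hp
  by_cases hcT : c ∈ T
  · have hdT : d ∈ T := by_contra fun h => hT c hcT d h hdX hcd
    exact key T (X \ T) (Set.union_sdiff_cancel hTX) (fun x hx h => h.2 hx) ⟨z, hz', hz⟩
      (fun x hx y hy => hT x hx y hy.2 hy.1) hcT hdT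
  · have hdT : d ∉ T := fun h => hT d h c hcT hcX hcd.symm
    exact key (X \ T) T (Set.sdiff_union_of_subset hTX) (fun x hx => hx.2) ⟨t, ht⟩
      (fun x hx y hy h => hT y hy x hx.2 hx.1 h.symm) ⟨hcX, hcT⟩ ⟨hdX, hdT⟩

end Structure

/-! ### Criticality of the six fixed graphs -/

section Critical

variable {V : Type u} {W : Type v} {k : ℕ}

instance : DecidableRel P₃.Adj := fun _ _ => decidable_of_iff _ pathGraph_adj.symm

instance (G : SimpleGraph V) (H : SimpleGraph W) [DecidableRel G.Adj] [DecidableRel H.Adj] :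
    DecidableRel (G ⊕g H).Adj
  | .inl _, .inl _ => decidable_of_iff _ sum_adj_inl.symm
  | .inr _, .inr _ => decidable_of_iff _ sum_adj_inr.symm
  | .inl _, .inr _ => isFalse (by simp)
  | .inr _, .inl _ => isFalse (by simp)

instance (G : SimpleGraph V) (H : SimpleGraph W) [DecidableRel G.Adj] [DecidableRel H.Adj] :
    DecidableRel (G ⊕j H).Adj
  | .inl _, .inl _ => decidable_of_iff _ join_adj_inl_inl.symm
  | .inr _, .inr _ => decidable_of_iff _ join_adj_inr_inr.symm
  | .inl _, .inr _ => isTrue join_adj_inl_inr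
  | .inr _, .inl _ => isTrue join_adj_inr_inl

/-- The graphs `F` for which `k K₁ + F` is a minimal obstruction to `(∞, k)`-polarity, apart from
the conditions that `F` is a connected cograph. -/
structure IsCritical (k : ℕ) (F : SimpleGraph W) : Prop where
  not_isCompleteMultipartite : ¬ F.IsCompleteMultipartite
  not_hasMonopolarColoring : ¬ HasMonopolarColoring k F
  hasPolarColoring_one : HasPolarColoring 1 F
  deletion : ∀ w, (F.induce {w}ᶜ).IsCompleteMultipartite ∨ HasMonopolarColoring k (F.induce {w}ᶜ)

section Decidable

variable (F : SimpleGraph W) (p : W → Bool)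

/-- The vertices satisfying `p` are pairwise nonadjacent. -/
def IndependentOn : Prop := ∀ a, p a → ∀ b, p b → ¬ F.Adj a b

/-- Nonadjacency is transitive on the vertices satisfying `p`. -/
def MultipartiteOn : Prop :=
  ∀ a, p a → ∀ b, p b → ¬ F.Adj a b → ∀ c, p c → ¬ F.Adj b c → ¬ F.Adj a c

/-- Adjacency is transitive on the vertices satisfying `p`. -/
def ClusterOn : Prop :=
  ∀ a, p a → ∀ b, p b → F.Adj a b → ∀ c, p c → F.Adj b c → a ≠ c → F.Adj a c

/-- Adjacency means having equal colours on the vertices satisfying `p` whose colour is not `0`. -/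
def ColoredOn (c : W → Fin 3) : Prop :=
  ∀ a, p a → c a ≠ 0 → ∀ b, p b → c b ≠ 0 → a ≠ b → (F.Adj a b ↔ c a = c b)

/-- The vertices satisfying `p` are pairwise adjacent. -/
def CliqueOn : Prop := ∀ a, p a → ∀ b, p b → a ≠ b → F.Adj a b

/-- No set of vertices is independent with a complement inducing a cluster. -/
def NotMonopolar : Prop := ∀ A : W → Bool, ¬ (IndependentOn F A ∧ ClusterOn F fun a => !A a)

variable [DecidableEq W]

/-- After the deletion of any vertex `w`, the graph is complete multipartite or `t w` is a
`(1, 2)`-polar colouring, where the colour `0` is the independent set. -/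
def IsDeletionTable (t : W → W → Fin 3) : Prop :=
  ∀ w, MultipartiteOn F (fun a => a ≠ w) ∨
    IndependentOn F (fun a => a ≠ w ∧ t w a = 0) ∧ ColoredOn F (fun a => a ≠ w) (t w)

variable [Fintype W] [DecidableRel F.Adj]

instance : Decidable (CliqueOn F p) := by unfold CliqueOn; infer_instance

instance : Decidable (IndependentOn F p) := by unfold IndependentOn; infer_instance

instance : Decidable (MultipartiteOn F p) := by unfold MultipartiteOn; infer_instance

instance : Decidable (ClusterOn F p) := by unfold ClusterOn; infer_instance

instance (c : W → Fin 3) : Decidable (ColoredOn F p c) := by unfold ColoredOn; infer_instance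

instance : Decidable (NotMonopolar F) := by unfold NotMonopolar; infer_instance

instance (t : W → W → Fin 3) : Decidable (IsDeletionTable F t) := by
  unfold IsDeletionTable; infer_instance

end Decidable

/-- `NotMonopolar` puts no bound on the number of clusters, so one finite check serves every `k`. -/
theorem NotMonopolar.not_hasMonopolarColoring {F : SimpleGraph W} (h : NotMonopolar F) :
    ¬ HasMonopolarColoring k F := by
  rintro ⟨f, hf, hn⟩
  refine h (fun w => (f w).isNone) ⟨fun a ha b hb => hn a b (by simpa using ha) (by simpa using hb),
    fun a ha b hb hab c hc hbc hac => ?_⟩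
  simp only [Option.not_isNone, Option.isSome_iff_exists] at ha hb hc
  obtain ⟨i, hi⟩ := ha
  obtain ⟨j, hj⟩ := hb
  obtain ⟨l, hl⟩ := hc
  rw [hf a c i l hi hl hac, (hf a b i j hi hj hab.ne).1 hab, (hf b c j l hj hl hbc.ne).1 hbc]

/-- The finite certificates: `B` is the clique of an `(∞, 1)`-polar partition, and row `w` of `t`
colours the graph without `w`; its entry at `w` itself is irrelevant. -/
theorem isCritical_of_table [DecidableEq W] (hk : 2 ≤ k) {F : SimpleGraph W}
    (hm : NotMonopolar F) (hc : ¬ MultipartiteOn F fun _ => true) (B : W → Bool)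
    (hB : CliqueOn F B) (hA : MultipartiteOn F fun a => !B a)
    (t : W → W → Fin 3)
    (ht : IsDeletionTable F t) : IsCritical k F where
  not_isCompleteMultipartite h := hc fun a _ b _ h1 c _ h2 => h.trans a b c h1 h2
  not_hasMonopolarColoring := hm.not_hasMonopolarColoring
  hasPolarColoring_one := by
    refine ⟨fun a => if B a then some 0 else none, fun a b i j ha hb hab => ?_,
      fun a b c ha hb hc h1 h2 => ?_⟩
    · simp only [Option.ite_none_right_eq_some] at ha hb
      simp [hB a ha.1 b hb.1 hab, Subsingleton.elim i j]
    · simp only [ite_eq_right_iff, reduceCtorEq, imp_false, Bool.not_eq_true] at ha hb hc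
      exact hA a (by simp [ha]) b (by simp [hb]) h1 c (by simp [hc]) h2
  deletion w := by
    have hw : ∀ a : ({w}ᶜ : Set W), decide (a.1 ≠ w) = true := fun a => by
      simp [show a.1 ≠ w from a.2]
    refine (ht w).imp (fun h => ⟨fun a b c h1 h2 => h a (hw a) b (hw b) h1 c (hw c) h2⟩) fun h => ?_
    -- The table colours `1`, `2` are shifted to `0`, `1`, both below `k`.
    refine ⟨fun a => if t w a = 0 then none else some ⟨(t w a).val - 1, by omega⟩,
      fun a b i j ha hb hab => ?_, fun a b ha hb => ?_⟩
    · simp only [Option.ite_none_left_eq_some, Option.some.injEq] at ha hb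
      rw [← ha.2, ← hb.2]
      have := h.2 a (hw a) ha.1 b (hw b) hb.1 (Subtype.coe_ne_coe.2 hab)
      have h1 := Fin.val_ne_zero_iff.2 ha.1
      have h2 := Fin.val_ne_zero_iff.2 hb.1
      simp only [comap_adj, Function.Embedding.subtype_apply, this, Fin.ext_iff]
      omega
    · simp only [ite_eq_left_iff, reduceCtorEq, imp_false, not_not] at ha hb
      exact h.1 a (by simp [ha, show a.1 ≠ w from a.2]) b (by simp [hb, show b.1 ≠ w from b.2])

theorem isCritical_compl_P₃_join_compl_P₃ (hk : 2 ≤ k) :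
    IsCritical k (P₃ᶜ ⊕j P₃ᶜ) :=
  let e : Fin 3 ⊕ Fin 3 → Fin 6 := Sum.elim ![0, 1, 2] ![3, 4, 5]
  isCritical_of_table hk (by decide +kernel) (by decide +kernel)
    (fun x => ![false, false, true, false, false, true] (e x)) (by decide +kernel)
    (by decide +kernel)
    (fun w x => !![0, 0, 0, 1, 2, 1; 1, 0, 1, 0, 0, 1; 0, 0, 0, 1, 2, 1;
      1, 2, 1, 0, 0, 0; 0, 0, 1, 1, 0, 1; 1, 2, 1, 0, 0, 0] (e w) (e x)) (by decide +kernel)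

theorem isCritical_P₃_sum_edge_join (hk : 2 ≤ k) :
    IsCritical k ((P₃ ⊕g K 2) ⊕j K 1) :=
  let e : (Fin 3 ⊕ Fin 2) ⊕ Fin 1 → Fin 6 := Sum.elim (Sum.elim ![0, 1, 2] ![3, 4]) ![5]
  isCritical_of_table hk (by decide +kernel) (by decide +kernel)
    (fun x => ![false, false, false, true, true, false] (e x)) (by decide +kernel)
    (by decide +kernel)
    (fun w x => !![0, 1, 1, 2, 2, 0; 0, 0, 0, 0, 1, 1; 1, 1, 0, 2, 2, 0;
      0, 1, 0, 0, 0, 1; 0, 1, 0, 0, 0, 1; 0, 1, 0, 0, 2, 0] (e w) (e x)) (by decide +kernel)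

theorem isCritical_two_edges_join_edge (hk : 2 ≤ k) :
    IsCritical k ((K 2 ⊕g K 2) ⊕j K 2) :=
  let e : (Fin 2 ⊕ Fin 2) ⊕ Fin 2 → Fin 6 := Sum.elim (Sum.elim ![0, 1] ![2, 3]) ![4, 5]
  isCritical_of_table hk (by decide +kernel) (by decide +kernel)
    (fun x => ![false, false, true, true, false, false] (e x)) (by decide +kernel)
    (by decide +kernel)
    (fun w x => !![0, 0, 0, 1, 1, 1; 0, 0, 0, 1, 1, 1; 0, 1, 0, 0, 1, 1;
      0, 1, 0, 0, 1, 1; 1, 1, 2, 2, 0, 0; 1, 1, 2, 2, 0, 0] (e w) (e x)) (by decide +kernel)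

theorem isCritical_join_C₄_sum (hk : 2 ≤ k) :
    IsCritical k (K 1 ⊕j (C₄ ⊕g K 1)) :=
  let e : Fin 1 ⊕ Fin 4 ⊕ Fin 1 → Fin 6 := Sum.elim ![0] (Sum.elim ![1, 2, 3, 4] ![5])
  isCritical_of_table hk (by decide +kernel) (by decide +kernel)
    (fun x => ![false, false, false, false, false, true] (e x)) (by decide +kernel)
    (by decide +kernel)
    -- The zero row is a filler: without the isolated vertex of `C₄ + K₁` the graph is complete
    -- multipartite.
    (fun w x => !![0, 0, 1, 0, 2, 0; 1, 0, 0, 1, 0, 0; 1, 0, 0, 0, 1, 0;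
      1, 1, 0, 0, 0, 0; 1, 0, 1, 0, 0, 0; 0, 0, 0, 0, 0, 0] (e w) (e x)) (by decide +kernel)

theorem isCritical_join_compl_P₃_join (hk : 2 ≤ k) :
    IsCritical k (K 1 ⊕j (P₃ᶜ ⊕j (K 2)ᶜ)) :=
  let e : Fin 1 ⊕ Fin 3 ⊕ Fin 2 → Fin 6 := Sum.elim ![0] (Sum.elim ![1, 2, 3] ![4, 5])
  isCritical_of_table hk (by decide +kernel) (by decide +kernel)
    (fun x => ![false, false, false, true, false, false] (e x)) (by decide +kernel)
    (by decide +kernel)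
    (fun w x => !![0, 1, 2, 1, 0, 0; 0, 0, 0, 0, 0, 0; 1, 1, 0, 1, 0, 0;
      0, 0, 0, 0, 0, 0; 1, 0, 0, 1, 0, 1; 1, 0, 0, 1, 1, 0] (e w) (e x)) (by decide +kernel)

theorem isCritical_nonedge_join_P₃_sum (hk : 2 ≤ k) :
    IsCritical k ((K 2)ᶜ ⊕j (P₃ ⊕g K 1)) :=
  let e : Fin 2 ⊕ Fin 3 ⊕ Fin 1 → Fin 6 := Sum.elim ![0, 1] (Sum.elim ![2, 3, 4] ![5])
  isCritical_of_table hk (by decide +kernel) (by decide +kernel)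
    (fun x => ![false, false, false, false, false, true] (e x)) (by decide +kernel)
    (by decide +kernel)
    (fun w x => !![0, 1, 0, 1, 0, 0; 1, 0, 0, 1, 0, 0; 0, 0, 0, 1, 1, 2;
      1, 2, 0, 0, 0, 0; 0, 0, 1, 1, 0, 2; 0, 0, 0, 0, 0, 0] (e w) (e x)) (by decide +kernel)

end Critical

/-! ### Criticality of the graph depending on `k` -/

section LastGraph

variable {k : ℕ}

theorem isCompleteMultipartite_deletion {W : Type u} {F : SimpleGraph W} {w : W}
    (h : ∀ a b c, a ≠ w → b ≠ w → c ≠ w → ¬ F.Adj a b → ¬ F.Adj b c → ¬ F.Adj a c) :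
    (F.induce {w}ᶜ).IsCompleteMultipartite :=
  ⟨fun a b c => h a b c a.2 b.2 c.2⟩

theorem hasMonopolarColoring_deletion {W : Type u} {F : SimpleGraph W} {w : W}
    (f : W → Option (Fin k))
    (hf : ∀ a b i j, a ≠ w → b ≠ w → f a = some i → f b = some j → a ≠ b → (F.Adj a b ↔ i = j))
    (hn : ∀ a b, a ≠ w → b ≠ w → f a = none → f b = none → ¬ F.Adj a b) :
    HasMonopolarColoring k (F.induce {w}ᶜ) :=
  ⟨fun a => f a, fun a b i j ha hb hab => hf a b i j a.2 b.2 ha hb (Subtype.coe_ne_coe.2 hab),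
    fun a b => hn a b a.2 b.2⟩

theorem isCritical_nonedge_join_edge_sum_isolated (hk : 2 ≤ k) :
    IsCritical k ((K 2)ᶜ ⊕j (K 2 ⊕g isolated k)) where
  not_isCompleteMultipartite h := by
    simpa using h.trans (.inr (.inl 0)) (.inr (.inr ⟨0, by omega⟩)) (.inr (.inl 1))
  not_hasMonopolarColoring h := by
    rcases h.of_join with (⟨-, h⟩ | ⟨-, f, hf⟩) | ⟨-, h⟩ | ⟨h, -⟩
    · have := congrArg (fun G => G.Adj (.inl 0) (.inr ⟨0, by omega⟩)) h
      simp at this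
    · let g : Option (Fin k) → Fin k := fun o => o.elim (f (.inl 0)) fun i => f (.inr i)
      have hg : Function.Injective g := by
        intro x y hxy
        by_contra hne
        rcases x with _ | x <;> rcases y with _ | y
        · exact hne rfl
        · simpa using (hf (.inl 0) (.inr y) _ _ rfl rfl (by simp)).2 hxy
        · simpa using (hf (.inr x) (.inl 0) _ _ rfl rfl (by simp)).2 hxy
        · simpa using (hf (.inr x) (.inr y) _ _ rfl rfl (by simpa using hne)).2 hxy
      simpa using Fintype.card_le_of_injective g hg
    · have := congrArg (fun G => G.Adj 0 1) h
      simp at this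
    · have := congrArg (fun G => G.Adj (.inl 0) (.inl 1)) h
      simp at this
  hasPolarColoring_one := by
    refine ⟨Sum.elim (fun _ => none) (Sum.elim (fun _ => some 0) fun _ => none), ?_, ?_⟩
    · rintro (a | a | a) (b | b | b) i j ha hb hab <;> simp_all
    · rintro (a | a | a) (b | b | b) (c | c | c) ha hb hc h1 h2 <;> simp_all
  deletion w := by
    rcases w with w | w | w
    · right
      -- The surviving vertex of the nonedge forms a triangle with the edge; the isolated vertices
      -- are the independent set.
      refine hasMonopolarColoring_deletion (Sum.elim (fun _ => some ⟨0, by omega⟩)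
        (Sum.elim (fun _ => some ⟨0, by omega⟩) fun _ => none)) ?_ ?_
      · rintro (a | a | a) (b | b | b) i j ha' hb' ha hb hab <;> simp_all
        omega
      · rintro (a | a | a) (b | b | b) ha' hb' ha hb <;> simp_all
    · left
      refine isCompleteMultipartite_deletion ?_
      rintro (a | a | a) (b | b | b) (c | c | c) ha' hb' hc' h1 h2 <;> simp_all
      all_goals omega
    · right
      -- The edge takes over the colour `w` freed by the deleted isolated vertex.
      refine hasMonopolarColoring_deletion
        (Sum.elim (fun _ => none) (Sum.elim (fun _ => some w) some)) ?_ ?_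
      · rintro (a | a | a) (b | b | b) i j ha' hb' ha hb hab <;> simp_all
        exact fun h => hb' h.symm
      · rintro (a | a | a) (b | b | b) ha' hb' ha hb <;> simp_all

end LastGraph

/-! ### The listed graphs are connected cographs -/

section Cographs

variable {V : Type u} {W : Type v} {G : SimpleGraph V} {H : SimpleGraph W}

/-- A surjective embedding is an isomorphism. -/
noncomputable def isoOfSurjective (φ : G ↪g H) (h : Function.Surjective φ) : G ≃g H :=
  RelIso.ofSurjective φ h

theorem join_connected [Nonempty V] [Nonempty W] : (G ⊕j H).Connected := by
  obtain ⟨x⟩ := ‹Nonempty V›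
  obtain ⟨y⟩ := ‹Nonempty W›
  have h : ∀ z, (G ⊕j H).Reachable (.inl x) z := by
    rintro (z | z)
    · exact (Adj.reachable (v := .inr y) (by simp)).trans (Adj.reachable (by simp))
    · exact Adj.reachable (by simp)
  exact (connected_iff _).2 ⟨fun a b => (h a).symm.trans (h b), ⟨.inl x⟩⟩

theorem IsCograph.join {V W : Type u} {G : SimpleGraph V} {H : SimpleGraph W} (hG : IsCograph G)
    (hH : IsCograph H) : IsCograph (G ⊕j H) := by
  simpa [compl_sum] using ((hG.compl.disjUnion _ _ hH.compl).compl)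

theorem isCograph_isolated {n : ℕ} (hn : n ≠ 0) : IsCograph (isolated n) := by
  have h1 : IsCograph (isolated 1) :=
    (IsCograph.single ⊥).iso _ _ ⟨(Equiv.ofUnique _ _), by simp⟩
  induction n, Nat.one_le_iff_ne_zero.2 hn using Nat.le_induction with
  | base => exact h1
  | succ n hn ih =>
    refine ((ih (by omega)).disjUnion _ _ h1).iso _ _ ⟨finSumFinEquiv, ?_⟩
    rintro (a | a) (b | b) <;> simp

theorem isCograph_K {n : ℕ} (hn : n ≠ 0) : IsCograph (K n) := by
  simpa using (isCograph_isolated hn).compl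

theorem isCograph_P₃ : IsCograph P₃ := by
  let φ : P₃ ↪g K 1 ⊕j (K 2)ᶜ := pathEmbedding (a := .inr 0) (b := .inl 0) (c := .inr 1)
    (by simp) (by simp) (by simp) (by simp)
  exact ((isCograph_K one_ne_zero).join (isCograph_K two_ne_zero).compl).iso _ _
    (isoOfSurjective φ ((Fintype.bijective_iff_injective_and_card φ).2
      ⟨φ.injective, by simp⟩).2).symm

theorem isCograph_C₄ : IsCograph C₄ := by
  let φ : C₄ ↪g (K 2)ᶜ ⊕j (K 2)ᶜ := cycleEmbedding (a := .inl 0) (b := .inr 0) (c := .inl 1)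
    (d := .inr 1) (by simp) (by simp) (by simp) (by simp) (by simp) (by simp) (by simp) (by simp)
  exact ((isCograph_K two_ne_zero).compl.join (isCograph_K two_ne_zero).compl).iso _ _
    (isoOfSurjective φ ((Fintype.bijective_iff_injective_and_card φ).2
      ⟨φ.injective, by simp⟩).2).symm

/-- An isomorphism of graphs is an isomorphism of their complements. -/
def complIso (e : G ≃g H) : Gᶜ ≃g Hᶜ where
  toEquiv := e.toEquiv
  map_rel_iff' := by
    intro a b
    have := e.map_adj_iff (v := a) (w := b)
    simp only [RelIso.coe_fn_toEquiv] at this ⊢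
    simp [compl_adj, this]

/-- Being a cograph does not depend on the universe of the vertex type. -/
theorem IsCograph.of_iso {V : Type} {G : SimpleGraph V} (h : IsCograph G) {W : Type v}
    {H : SimpleGraph W} (e : G ≃g H) : IsCograph H := by
  induction h generalizing W with
  | single G =>
    refine (IsCograph.single ⊥).iso _ _ ⟨Equiv.punitEquivPUnit.trans e.toEquiv, ?_⟩
    intro a b
    simp [Subsingleton.elim a b]
  | compl G _ ih => simpa using (ih (by simpa using complIso e : G ≃g Hᶜ)).compl
  | disjUnion G₁ G₂ _ _ ih₁ ih₂ =>
    -- Disjoint unions of cographs must be formed in the target universe, so both summands are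
    -- lifted there first.
    let e₁ := Iso.map Equiv.ulift.{v}.symm G₁
    let e₂ := Iso.map Equiv.ulift.{v}.symm G₂
    exact ((ih₁ e₁).disjUnion _ _ (ih₂ e₂)).iso _ _ ((Iso.sumCongr e₁ e₂).symm.trans e)
  | iso G₁ G₂ f _ ih => exact ih (f.trans e)

instance [Nonempty V] [Nonempty W] : Nontrivial (V ⊕ W) :=
  let ⟨x⟩ := ‹Nonempty V›
  let ⟨y⟩ := ‹Nonempty W›
  ⟨.inl x, .inr y, by simp⟩

theorem InList.exists_iso {k : ℕ} (hk : 2 ≤ k) (h : InList k H) :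
    ∃ (X : Type) (F : SimpleGraph X), Nonempty (H ≃g F) ∧ IsCritical k F ∧ F.Connected ∧
      Nontrivial X ∧ IsCograph F := by
  have h1 := isCograph_K one_ne_zero
  have h2 := isCograph_K two_ne_zero
  have hP := isCograph_P₃
  rw [InList, compl_sum, compl_sum] at h
  rcases h with h | h | h | h | h | h | h
  · exact ⟨_, _, h, isCritical_compl_P₃_join_compl_P₃ hk, join_connected, inferInstance,
      hP.compl.join hP.compl⟩
  · exact ⟨_, _, h, isCritical_P₃_sum_edge_join hk, join_connected, inferInstance,
      (hP.disjUnion _ _ h2).join h1⟩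
  · exact ⟨_, _, h, isCritical_two_edges_join_edge hk, join_connected, inferInstance,
      (h2.disjUnion _ _ h2).join h2⟩
  · exact ⟨_, _, h, isCritical_join_C₄_sum hk, join_connected, inferInstance,
      h1.join (isCograph_C₄.disjUnion _ _ h1)⟩
  · exact ⟨_, _, h, isCritical_join_compl_P₃_join hk, join_connected, inferInstance,
      h1.join (hP.compl.join h2.compl)⟩
  · exact ⟨_, _, h, isCritical_nonedge_join_P₃_sum hk, join_connected, inferInstance,
      h2.compl.join (hP.disjUnion _ _ h1)⟩
  · exact ⟨_, _, h, isCritical_nonedge_join_edge_sum_isolated hk, join_connected, inferInstance,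
      h2.compl.join (h2.disjUnion _ _ (isCograph_isolated (by omega)))⟩

end Cographs

/-! ### Types and isolated vertices -/

section Types

variable {V : Type u} {W : Type v} {G : SimpleGraph V} {H : SimpleGraph W} {k : ℕ}

theorem hasType_of_iso [Finite V] [Nontrivial W] (hH : H.Connected) (e : G ≃g isolated k ⊕g H) :
    HasType (k + 1) k G := by
  -- Collapsing the connected graph `H` to a point makes the fibres of `p` exactly the components of
  -- `G`.
  let p : V → Fin k ⊕ Unit := fun v => Sum.map id (fun _ => ()) (e v)
  have hinl : ∀ v i, p v = .inl i ↔ v = e.symm (.inl i) := fun v i => by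
    change Sum.map id _ (e v) = _ ↔ v = e.toEquiv.symm _
    rw [Equiv.eq_symm_apply]
    change _ ↔ e v = _
    rcases e v with j | w <;> simp
  have hp : ∀ a b, G.Reachable a b ↔ p a = p b := fun a b => by
    rw [← e.reachable_iff]
    change (isolated k ⊕g H).Reachable (e a) (e b) ↔
      Sum.map id (fun _ => ()) (e a) = Sum.map id (fun _ => ()) (e b)
    generalize e a = x
    generalize e b = y
    constructor
    · intro h
      refine mem_of_reachable
        (T := {y | Sum.map id (fun _ => ()) x = Sum.map id (fun _ => ()) y}) ?_ h rfl
      rintro (a | a) ha (b | b) hb <;> simp_all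
    · rcases x with x | x <;> rcases y with y | y <;> intro h <;> simp at h
      · rw [h]
      · exact (hH.preconnected x y).map Embedding.sumInr.toHom
  obtain ⟨x, y, hxy⟩ := exists_pair_ne W
  have hsurj : Function.Surjective p := by
    rintro (i | _)
    · exact ⟨_, (hinl _ i).2 rfl⟩
    · exact ⟨e.symm (.inr x), by simp [p]⟩
  let E : G.ConnectedComponent ≃ Fin k ⊕ Unit := Equiv.ofBijective
    (Quot.lift p fun a b h => (hp a b).1 h) ⟨by
      rintro ⟨a⟩ ⟨b⟩ h
      exact ConnectedComponent.sound ((hp a b).2 h), fun c => by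
      obtain ⟨v, hv⟩ := hsurj c
      exact ⟨Quot.mk _ v, hv⟩⟩
  have hE : ∀ c v, v ∈ c.supp ↔ p v = E c := fun c v => by
    rw [ConnectedComponent.mem_supp_iff, ← E.apply_eq_iff_eq]
    rfl
  refine ⟨by rw [Nat.card_congr E]; simp, ?_⟩
  have hcard : ∀ c : G.ConnectedComponent, Nat.card c.supp = 1 ↔ (E c).isLeft := fun c => by
    rcases h : E c with i | j
    · have : c.supp = {e.symm (.inl i)} := by
        ext v
        rw [hE, h, hinl, Set.mem_singleton_iff]
      simp [this]
    · simp only [Sum.isLeft_inr, Bool.false_eq_true, iff_false]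
      intro h1
      have := (Nat.card_eq_one_iff_unique.1 h1).1
      have hmem : ∀ z, e.symm (.inr z) ∈ c.supp := fun z => by
        rw [hE, h]; simp [p]
      have := Subsingleton.elim (⟨_, hmem x⟩ : c.supp) ⟨_, hmem y⟩
      simp [hxy] at this
  rw [Nat.card_congr (E.subtypeEquiv (q := fun x => x.isLeft) hcard),
    Nat.card_congr (Equiv.ofBijective (fun i : Fin k =>
      (⟨.inl i, rfl⟩ : {x : Fin k ⊕ Unit // x.isLeft}))
        ⟨fun i j h => Sum.inl_injective (congrArg Subtype.val h), ?_⟩).symm,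
    Nat.card_fin]
  rintro ⟨i | j, h⟩
  · exact ⟨i, rfl⟩
  · simp at h

/-- A graph of type `(k + 1, k)` consists of `k` isolated vertices and a nontrivial component. -/
theorem HasType.exists_iso [Finite V] (h : HasType (k + 1) k G) :
    ∃ S : Set V, (G.induce S).Connected ∧ Nontrivial S ∧
      Nonempty (isolated k ⊕g G.induce S ≃g G) := by
  obtain ⟨h1, h2⟩ := h
  let T : Set G.ConnectedComponent := {C | Nat.card C.supp = 1}
  have hT : T.ncard = k := h2
  have hTc : Tᶜ.ncard = 1 := by
    have := Set.ncard_add_ncard_compl T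
    omega
  obtain ⟨C, hC⟩ := Set.ncard_eq_one.1 hTc
  have hmem : ∀ D, D ∉ T ↔ D = C := fun D => by
    rw [← Set.mem_compl_iff, hC, Set.mem_singleton_iff]
  have hCT : C ∉ T := (hmem C).2 rfl
  let r : Fin k ≃ T := (Finite.equivFinOfCardEq h2).symm
  have hr : ∀ i v, v ∈ (r i).1.supp → v = (r i).1.out := fun i v hv => by
    have := (Nat.card_eq_one_iff_unique.1 (r i).2).1
    exact congrArg Subtype.val
      (Subsingleton.elim (⟨v, hv⟩ : (r i).1.supp) ⟨_, Quot.out_eq (r i).1⟩)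
  have hout : ∀ D : G.ConnectedComponent, G.connectedComponentMk D.out = D := fun D => Quot.out_eq D
  have hadj : ∀ i v, ¬ G.Adj (r i).1.out v := fun i v h => by
    refine h.ne (hr i v ?_).symm
    rw [ConnectedComponent.mem_supp_iff, ← hout (r i).1]
    exact ConnectedComponent.sound h.symm.reachable
  let ρ : isolated k ↪g G := embeddingOfAdj (fun i => (r i).1.out)
    (fun i j hij => r.injective <| Subtype.ext <| by
      rw [← hout (r i).1, ← hout (r j).1]
      exact congrArg _ hij) (fun i j => by simp [hadj])
  refine ⟨C.supp, C.connected_toSimpleGraph, ?_, ⟨isoOfSurjective (sumEmbedding ρ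
    (Embedding.induce C.supp) fun i v => ⟨fun h => ?_, hadj i v⟩) fun v => ?_⟩⟩
  · rw [← not_subsingleton_iff_nontrivial]
    intro h
    obtain ⟨v, hv⟩ := C.nonempty_supp
    exact hCT (Nat.card_eq_one_iff_unique.2 ⟨h, ⟨v, hv⟩⟩)
  · refine (hmem (r i).1).2 ?_ (r i).2
    rw [← hout (r i).1]
    exact (congrArg G.connectedComponentMk h).trans v.2
  · by_cases hv : G.connectedComponentMk v = C
    · exact ⟨.inr ⟨v, hv⟩, rfl⟩
    · have hvT : G.connectedComponentMk v ∈ T := by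
        by_contra h
        exact hv ((hmem _).1 h)
      obtain ⟨i, hi⟩ := r.surjective ⟨_, hvT⟩
      refine ⟨.inl i, (hr i v ?_).symm⟩
      rw [hi]
      rfl

end Types

/-! ### Minimality in terms of `H` -/

section Obstructions

variable {V : Type u} {W : Type v} {G : SimpleGraph V} {H : SimpleGraph W} {k : ℕ}

theorem IsMinimalObstruction.hasPolarColoring (h : IsMinimalObstruction ⊤ (k : ℕ∞) G)
    (φ : H ↪g G) (hφ : ¬ Function.Surjective φ) : HasPolarColoring k H := by
  have := isPolar_top_iff.1 (h.2.2 (Set.range φ) (by rwa [Ne, Set.range_eq_univ]))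
  exact this.comap ⟨⟨fun x => ⟨φ x, x, rfl⟩, fun x y h => φ.injective (congrArg Subtype.val h)⟩,
    φ.map_adj_iff⟩

/-- If the multipartite side contains an edge of `H`, the `k` isolated vertices take distinct
colours among `k + 1`, leaving a single colour for `H`. -/
theorem HasPolarColoring.one_or_hasMonopolarColoring
    (h : HasPolarColoring (k + 1) (isolated k ⊕g H)) :
    HasPolarColoring 1 H ∨ HasMonopolarColoring (k + 1) H := by
  obtain ⟨f, hf, hn⟩ := h
  by_cases hind : ∀ a b, f (.inr a) = none → f (.inr b) = none → ¬ H.Adj a b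
  · exact Or.inr ⟨_, hf.comap (Embedding.sumInr (G := isolated k)), hind⟩
  left
  push Not at hind
  obtain ⟨a, b, ha, hb, hab⟩ := hind
  have hiso : ∀ i, f (.inl i) ≠ none := fun i hi => by
    simpa [hab] using hn (.inr a) (.inl i) (.inr b) ha hi hb
  choose g hg using fun i => Option.ne_none_iff_exists'.1 (hiso i)
  have hinj : Function.Injective g := fun i j hij => by
    by_contra hne
    simpa [hij] using hf _ _ _ _ (hg i) (hg j) (by simpa using hne)
  have hcard : ((Finset.univ.image g)ᶜ).card = 1 := by
    rw [Finset.card_compl, Finset.card_image_of_injective _ hinj]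
    simp
  obtain ⟨c, hc⟩ := Finset.card_eq_one.1 hcard
  have hcol : ∀ x i, f (.inr x) = some i → i = c := fun x i hx => by
    rw [← Finset.mem_singleton, ← hc, Finset.mem_compl, Finset.mem_image]
    rintro ⟨j, -, rfl⟩
    simpa using hf _ _ _ _ (hg j) hx (by simp)
  refine ⟨fun x => (f (.inr x)).map fun _ => 0, ?_, ?_⟩
  · intro x y i j hx hy hxy
    simp only [Option.map_eq_some_iff] at hx hy
    obtain ⟨i', hx, -⟩ := hx
    obtain ⟨j', hy, -⟩ := hy
    simpa [Subsingleton.elim i j, hcol x i' hx, hcol y j' hy] using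
      hf _ _ _ _ hx hy (by simpa using hxy)
  · intro x y z hx hy hz
    simpa using hn (.inr x) (.inr y) (.inr z) (by simpa using hx) (by simpa using hy)
      (by simpa using hz)

theorem IsCritical.hasPolarColoring_deletion (hH : IsCritical k H) (x : Fin k ⊕ W) :
    HasPolarColoring k ((isolated k ⊕g H).induce {x}ᶜ) := by
  rcases x with i | w
  -- The deleted isolated vertex frees the colour `i` for the clique of an `(∞, 1)`-polar partition
  -- of `H`.
  · obtain ⟨f, hf, hn⟩ := hH.hasPolarColoring_one
    refine ⟨fun x => Sum.elim some (fun w => (f w).map fun _ => i) x.1, ?_, ?_⟩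
    · rintro ⟨a | a, ha'⟩ ⟨b | b, hb'⟩ j l ha hb hab
      · have : a ≠ b := fun h => hab (by simp [h])
        have h1 : a = j := by simpa using ha
        have h2 : b = l := by simpa using hb
        simpa [← h1, ← h2] using this
      · have h1 : a = j := by simpa using ha
        have h2 : i = l := by simp at hb; exact hb.2
        have : a ≠ i := fun h => ha' (by simp [h])
        simpa [← h1, ← h2] using this
      · have h1 : i = j := by simp at ha; exact ha.2
        have h2 : b = l := by simpa using hb
        have : b ≠ i := fun h => hb' (by simp [h])
        simpa [← h1, ← h2] using this.symm
      · simp only [Sum.elim_inr, Option.map_eq_some_iff] at ha hb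
        obtain ⟨a', ha, rfl⟩ := ha
        obtain ⟨b', hb, rfl⟩ := hb
        have : a ≠ b := fun h => hab (by simp [h])
        simpa [Subsingleton.elim a' b'] using hf _ _ _ _ ha hb this
    · rintro ⟨a | a, ha'⟩ ⟨b | b, hb'⟩ ⟨c | c, hc'⟩ ha hb hc <;> simp at ha hb hc
      simpa using hn a b c ha hb hc
  · have : HasPolarColoring k (isolated k ⊕g H.induce {w}ᶜ) :=
      hasPolarColoring_isolated_sum_iff.2 (hH.deletion w)
    let g : ({.inr w}ᶜ : Set (Fin k ⊕ W)) → Fin k ⊕ ({w}ᶜ : Set W) := fun x =>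
      match x with
      | ⟨.inl i, _⟩ => .inl i
      | ⟨.inr y, h⟩ => .inr ⟨y, fun h' => h (congrArg Sum.inr h')⟩
    refine this.comap (embeddingOfAdj g ?_ ?_)
    · rintro ⟨a | a, ha⟩ ⟨b | b, hb⟩ <;> simp [g]
    · rintro ⟨a | a, ha⟩ ⟨b | b, hb⟩ <;> simp [g]

/-- A proper induced subgraph misses some vertex, so polarity of the vertex deletions suffices. -/
theorem isMinimalObstruction_of_iso (hc : IsCograph G)
    (hH : IsCritical k H) (e : G ≃g isolated k ⊕g H) : IsMinimalObstruction ⊤ (k : ℕ∞) G := by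
  refine ⟨hc, fun h => ?_, fun S hS => ?_⟩
  · exact (hasPolarColoring_isolated_sum_iff.1
      ((isPolar_top_iff.1 h).comap e.symm.toEmbedding)).elim hH.1 hH.2
  · obtain ⟨v, hv⟩ := (Set.ne_univ_iff_exists_notMem S).1 hS
    refine isPolar_top_iff.2 ((hH.hasPolarColoring_deletion (e v)).comap
      ⟨⟨fun x => ⟨e x, fun h => hv (e.injective h ▸ x.2)⟩, fun x y h => ?_⟩, e.map_adj_iff⟩)
    exact Subtype.ext (e.injective (congrArg Subtype.val h))

end Obstructions

end CographPolar

theorem mainTheorem9 {V : Type*} [Finite V] (G : SimpleGraph V) (k : ℕ) (hk : 2 ≤ k) :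
    (CographPolar.IsMinimalObstruction ⊤ (k : ℕ∞) G ∧ CographPolar.HasType (k + 1) k G) ↔
      ∃ (W : Type) (H : SimpleGraph W),
        CographPolar.InList k H ∧ Nonempty (G ≃g CographPolar.isolated k ⊕g H) := by
  open CographPolar SimpleGraph in
  constructor
  · rintro ⟨hG, hT⟩
    obtain ⟨S, hconn, hnt, ⟨e⟩⟩ := hT.exists_iso
    have hnot : ¬ HasPolarColoring k (isolated k ⊕g G.induce S) := fun h =>
      hG.2.1 (isPolar_top_iff.2 (h.comap e.symm.toEmbedding))
    rw [hasPolarColoring_isolated_sum_iff, not_or] at hnot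
    have hsub : ∀ {X : Type} {F : SimpleGraph X} (φ : F ↪g G.induce S), ¬ Function.Surjective φ →
        F.IsCompleteMultipartite ∨ HasMonopolarColoring k F := fun {X F} φ hφ => by
      rw [← hasPolarColoring_isolated_sum_iff]
      refine hG.hasPolarColoring ((Embedding.sum Embedding.refl φ).trans e.toEmbedding) fun h => hφ
        fun y => ?_
      obtain ⟨x | x, hx⟩ := h (e (.inr y))
      · simpa using e.injective hx
      · exact ⟨x, by simpa using e.injective hx⟩
    have h1 : HasPolarColoring 1 (G.induce S) := by
      -- Minimality is applied to `G` with one isolated vertex removed.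
      obtain ⟨m, rfl⟩ : ∃ m, k = m + 1 := ⟨k - 1, by omega⟩
      refine (HasPolarColoring.one_or_hasMonopolarColoring (hG.hasPolarColoring ((Embedding.sum
        (embeddingOfAdj Fin.succ (Fin.succ_injective m) (by simp) : isolated m ↪g isolated (m + 1))
        Embedding.refl).trans e.toEmbedding) fun h => ?_)).resolve_right hnot.2
      obtain ⟨x | x, hx⟩ := h (e (.inl 0))
      · exact Fin.succ_ne_zero x (Sum.inl_injective (e.injective hx))
      · simpa using e.injective hx
    obtain ⟨X, F, hF, ⟨φ⟩⟩ := containsListed hk (hG.1.isSeparable.comap (Embedding.induce S)) hconn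
      hnot.1 hnot.2 h1
    -- A proper copy of a listed graph would, by minimality, be complete multipartite or monopolar,
    -- which no listed graph is.
    have hφ : Function.Surjective φ := by
      by_contra hφ
      obtain ⟨X', F', ⟨e'⟩, hF', -⟩ := hF.exists_iso hk
      exact (hsub φ hφ).elim (fun h => hF'.1 (h.comap e'.symm.toEmbedding))
        fun h => hF'.2 (h.comap e'.symm.toEmbedding)
    exact ⟨X, F, hF, ⟨e.symm.trans (Iso.sumCongr Iso.refl (isoOfSurjective φ hφ).symm)⟩⟩
  · rintro ⟨W, H, hH, ⟨e⟩⟩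
    obtain ⟨X, F, ⟨e'⟩, hF, hconn, hnt, hcog⟩ := hH.exists_iso hk
    let e₁ := e.trans (Iso.sumCongr Iso.refl e')
    exact ⟨isMinimalObstruction_of_iso (((isCograph_isolated (by omega)).disjUnion _ _ hcog).of_iso
      e₁.symm) hF e₁, hasType_of_iso hconn e₁⟩
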